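/- **Theorem (network tomography for link congestion).** *Setting.* Let $\mathcal N=(\mathcal V,\mathcal E)$ be a finite connected simple undirected graph with $n=|\mathcal E|\ge 2$ links and diameter $D$. Let $M\ge 2$ and $k\ge 1$ be integers, and let $\rho$ be real with $\rho\ge\rho_0$ and $\rho k\le n$, where $\rho_0>0$ is a fixed constant. Put $\ell=\lceil\log n/\log M\rceil$. Every link $e$ has an unknown delay $d_e\in\mathbb R$, and at most $k$ of the $d_e$ are non-zero. A *path* is a walk in $\mathcal N$ (nodes and links may repeat). $W(P,e)$ is the number of times the path $P$ crosses $e$ (in either direction), the delay of $P$ is $\Delta(P)=\sum_e W(P,e)d_e$, the number of hops of $P$ is $\sum_e W(P,e)$, and $P$ *traverses* the links $e$ with $W(P,e)\ge1$. *The FRANTIC scheme* with parameters $\mu,R,T\in\mathbb N$: - **Matrix (SHO-FA-INT ensemble).** Each link $e$ independently picks three distinct groups in $\{1,\dots,\mu\}$ uniformly at random, its neighbours. The $3n$ pairs ($e$, neighbour $i$ of $e$) receive distinct vectors $a_{ie}\in\{1,\dots,M\}^R$, each with greatest common divisor $1$ of its entries, drawn uniformly without replacement. If $i$ is not a neighbour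 of $e$, then $a_{ie}=0$. The matrix $A$ has $\mu R$ rows; row $(i,r)$ has entry $a_{ie}^{(r)}$ in column $e$. - **Measurements.** For each row $a$ of $A$, the *spanning path* $P$ goes through the links $e$ with $a_e\neq0$ one by one, moving to the next such link along a shortest path. The *weighted path* $Q$ follows $P$ and, on the first crossing of each link $e$, crosses $e$ back and forth $a_e$ further times. The delays $\Delta(P),\Delta(Q)$ are measured, and $y=(\Delta(Q)-\Delta(P))/2$. - **Decoding (peeling).** Start with $\hat d=0$, the residual $\tilde y=y$ (a vector $\tilde y_i\in\mathbb R^R$ for each group $i$), and the set of groups with $\tilde y_i\neq0$. At most $T$ times, and only while this set is non-empty, draw a group $i$ uniformly at random from it. If $\tilde y_i=\delta a_{ie}$ for a real $\delta\neq0$ and a link $e$ neighbouring $i$ (found by looking up the normalised vector $\tilde y_i$ in a stored table for group $i$), add $\delta$ to $\hat d_e$, subtract $\delta a_{i'e}$ from $\tilde y_{i'}$ for the three neighbours $i'$ of $e$, and update the set. Output $\hat d$. Operations counted: arithmetic operations and comparisons on numbers, one table probe per coordinate of a key, updates and emptiness tests of the set, and random draws. *Claim.* There are constants $c_1,c_3,C>0$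 and an integer $c_2\ge1$, depending only on $\rho_0$, such that in every such setting, with $\mu=\lceil c_1\rho k\rceil$, $R=c_2\ell$ and $T=\lceil c_3\rho k\rceil$, one has $R\ge2$ and $M^R/\zeta(R)\ge 3n$, the ensemble is non-empty, and: 1. FRANTIC uses $\mu R\le C\rho k\,\lceil\log n/\log M\rceil$ pairs of path measurements. For every outcome of the design and every row $a$, $P$ visits every $e$ with $a_e\ne0$, $W(Q,e)=W(P,e)+2a_e$ for every $e$, and $(\Delta(Q)-\Delta(P))/2=\sum_e a_ed_e$. 2. For every fixed $d\in\mathbb R^{\mathcal E}$ with at most $k$ non-zero entries, $\hat d=d$ with probability at least $1-C/(\rho k)$ over the design and the random draws of the decoder. 3. The decoder always uses at most $C\rho k\,\lceil\log n/\log M\rceil$ operations. 4. Each test packet (the $P$ or the $Q$ of a row) traverses $O(Dn/(\rho k))$ links and makes $O(DMn/(\rho k))$ hops, in the following senses. The expected number of links is at most $CDn/(\rho k)$ and the expected number of hops is at most $CDMn/(\rho k)$. For each packet, with probability at least $1-e^{-n/(\rho k)}$, it traverses at most $CDn/(\rho k)$ links and makes at most $CDMn/(\rho k)$ hops. With probability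 at least $1-C\rho k\,e^{-n/(\rho k)}$, these two bounds hold for all packets simultaneously. -/

import Mathlib

/-! ## Paths in a network -/

namespace Frantic

/-- A path in the network `G`: a walk, in which nodes and links may be repeated. -/
structure NetPath {V : Type*} (G : SimpleGraph V) where
  src : V
  dst : V
  walk : G.Walk src dst

namespace NetPath

variable {V : Type*} {G : SimpleGraph V}

/-- Total number of hops: the length of the path, links counted with multiplicity. -/
def hops (P : NetPath G) : ℕ := P.walk.length

/-- The multiplicity `W(P, e)`: how often `P` visits the link `e`, in either direction. -/
def mult [DecidableEq V] (P : NetPath G) (e : G.edgeSet) : ℕ := P.walk.edges.count e.1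

/-- Number of (distinct) links of the network that `P` traverses. -/
def links [DecidableEq V] (P : NetPath G) : ℕ := P.walk.edges.toFinset.card

/-- End-to-end delay of `P` when the link `e` delays every passing packet by `d e`. -/
def delay (P : NetPath G) (d : G.edgeSet → ℝ) : ℝ :=
  (P.walk.darts.map fun a => d ⟨a.edge, a.edge_mem⟩).sum

/-- `P` is a `w`-spanning measurement. -/
def IsSpanning [DecidableEq V] (P : NetPath G) (w : G.edgeSet → ℕ) : Prop :=
  ∀ e, w e ≠ 0 → 1 ≤ P.mult e

/-- `Q` is a `(w, P)`-weighted measurement. -/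
def IsWeighted [DecidableEq V] (Q P : NetPath G) (w : G.edgeSet → ℕ) : Prop :=
  ∀ e, Q.mult e = P.mult e + 2 * w e

end NetPath

/-! ## The two measurement paths of a weight vector -/

section Paths

variable {V : Type*} {G : SimpleGraph V}

/-- A shortest path between two nodes. -/
noncomputable def geodesic (hG : G.Connected) (u v : V) : G.Walk u v :=
  (hG.exists_walk_length_eq_dist u v).choose

/-- A link with one of its two directions. -/
noncomputable def orient (e : G.edgeSet) : G.Dart :=
  ⟨Quot.out e.1, by
    have h : G.Adj (Quot.out e.1).1 (Quot.out e.1).2 ↔ s((Quot.out e.1).1, (Quot.out e.1).2) ∈ G.edgeSet :=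
      (SimpleGraph.mem_edgeSet G).symm
    rw [h]
    have h2 : s((Quot.out e.1).1, (Quot.out e.1).2) = e.1 := Quot.out_eq e.1
    rw [h2]
    exact e.2⟩

/-- From the node `u`, go to the listed links one after the other, each time along a shortest
path to the tail of the link, and cross the link. -/
noncomputable def tour (hG : G.Connected) : (l : List G.Dart) → (u : V) → Σ v, G.Walk u v
  | [], u => ⟨u, .nil⟩
  | a :: l, u =>
      ⟨(tour hG l a.snd).1,
        (geodesic hG u a.fst).append (.cons a.adj (tour hG l a.snd).2)⟩

/-- The spanning path of `w`: it starts at the first link of the support of `w` and visits the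
links of the support one by one (in some fixed order). -/
noncomputable def spanningPath [Fintype G.edgeSet] (hG : G.Connected) (w : G.edgeSet → ℕ) :
    NetPath G :=
  match ((Finset.univ.filter fun e => w e ≠ 0).toList.map orient : List G.Dart) with
  | [] => ⟨hG.nonempty.some, hG.nonempty.some, .nil⟩
  | a :: l => ⟨a.fst, (tour hG (a :: l) a.fst).1, (tour hG (a :: l) a.fst).2⟩

/-- Having just crossed the link `u v`, cross it back and forth `m` more times, then follow `p`. -/
def bounce {u v x : V} (h : G.Adj u v) : ℕ → G.Walk v x → G.Walk v x
  | 0, p => p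
  | m + 1, p => .cons h.symm (.cons h (bounce h m p))

/-- Follow a walk and add `w e` local loops (back and forth) at the first visit of each link `e`;
`seen` lists the links visited so far. -/
def addLoops [DecidableEq V] (w : G.edgeSet → ℕ) :
    List (Sym2 V) → {u v : V} → G.Walk u v → G.Walk u v
  | _, _, _, .nil => .nil
  | seen, _, _, .cons (u := u) (v := v) h p =>
      .cons h (bounce h (if s(u, v) ∈ seen then 0 else w ⟨s(u, v), h⟩)
        (addLoops w (s(u, v) :: seen) p))

/-- The weighted path that belongs to `w` and `P`. -/
def weightedPath [DecidableEq V] (w : G.edgeSet → ℕ) (P : NetPath G) : NetPath G :=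
  ⟨P.src, P.dst, addLoops w [] P.walk⟩

end Paths

/-! ## The ensemble of integer measurement matrices -/

section Ensemble

/-- The vectors in `{1, …, M}^R` whose entries have greatest common divisor `1`. -/
abbrev PrimVec (M R : ℕ) : Type :=
  {c : Fin R → ↥(Finset.Icc 1 M) // (Finset.univ.gcd fun r => (c r : ℕ)) = 1}

/-- An outcome of the random design with `μ` groups of `R` rows and columns indexed by `E`:
every column `e` (left vertex) gets an ordered triple of distinct groups (its right neighbours),
and the `3|E|` edges `(e, p)` of the bipartite graph get distinct vectors of `PrimVec M R`. -/
abbrev Design (E : Type*) (μ R M : ℕ) : Type _ :=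
  (E → (Fin 3 ↪ Fin μ)) × ((E × Fin 3) ↪ PrimVec M R)

namespace Design

variable {E : Type*} {μ R M : ℕ}

/-- The `p`-th neighbour (group) of the column `e`. -/
def nbr (A : Design E μ R M) (e : E) (p : Fin 3) : Fin μ := A.1 e p

/-- The weight vector on the `p`-th edge at `e`. -/
def weight (A : Design E μ R M) (e : E) (p : Fin 3) (r : Fin R) : ℕ := (A.2 (e, p)).1 r

/-- The measurement matrix. Row `(i, r)` is the `r`-th row of the `i`-th group. -/
def matrix (A : Design E μ R M) : Matrix (Fin μ × Fin R) E ℕ :=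
  fun ir e => ∑ p : Fin 3, if A.nbr e p = ir.1 then A.weight e p ir.2 else 0

end Design

/-- The random design: all outcomes are equally likely, that is, the triples of neighbours are
independent and uniform, and the weight vectors are drawn uniformly without replacement. -/
noncomputable def ensemble (E : Type*) [Fintype E] [DecidableEq E] (μ R M : ℕ)
    [Nonempty (Design E μ R M)] : PMF (Design E μ R M) :=
  PMF.uniformOfFintype (Design E μ R M)

end Ensemble

/-! ## Computations with a count of the operations -/

/-- A result together with the number of operations spent on it. An operation is an arithmetic
operation or a comparison of two numbers, a probe of a stored table for one coordinate of a key,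
or an update or emptiness test of the list of active groups, or a random draw from it. -/
structure Counted (α : Type*) where
  val : α
  ops : ℕ

namespace Counted

def pure {α : Type*} (a : α) : Counted α := ⟨a, 0⟩

def bind {α β : Type*} (x : Counted α) (f : α → Counted β) : Counted β :=
  ⟨(f x.val).val, x.ops + (f x.val).ops⟩

/-- Perform all the computations of a finite family; the costs add up. -/
def all {ι α : Type*} [Fintype ι] (f : ι → Counted α) : Counted (ι → α) :=
  ⟨fun i => (f i).val, ∑ i, (f i).ops⟩

noncomputable def add (x y : ℝ) : Counted ℝ := ⟨x + y, 1⟩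
noncomputable def sub (x y : ℝ) : Counted ℝ := ⟨x - y, 1⟩
noncomputable def mul (x y : ℝ) : Counted ℝ := ⟨x * y, 1⟩
noncomputable def div (x y : ℝ) : Counted ℝ := ⟨x / y, 1⟩

/-- Compare a number with zero. -/
noncomputable def isZero (x : ℝ) : Counted Bool := ⟨decide (x = 0), 1⟩

/-- Add up `R` numbers. -/
noncomputable def sum {R : ℕ} (y : Fin R → ℝ) : Counted ℝ := ⟨∑ r, y r, R⟩

/-- Compare `R` numbers with zero: are all of them zero? -/
noncomputable def isZeroVec {R : ℕ} (y : Fin R → ℝ) : Counted Bool := ⟨decide (y = 0), R⟩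

/-- Modify an entry of a list of flags. -/
def touch {α : Type*} (a : α) : Counted α := ⟨a, 1⟩

end Counted

/-! ## The peeling decoder -/

section Decoder

variable {E : Type*} {μ R M : ℕ}

/-- State of the decoder: the reconstruction vector, the residual measurements, and the set of
groups whose residual is not zero. -/
structure State (E : Type*) (μ R : ℕ) where
  dhat : E → ℝ
  res : Fin μ → Fin R → ℝ
  active : Finset (Fin μ)

/-- All-zero reconstruction vector, residual `y`; building the list of active groups takes
`R` comparisons and one update of the list for each group. -/
noncomputable def initState (E : Type*) (y : Fin μ → Fin R → ℝ) : Counted (State E μ R) :=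
  (Counted.all fun i => (Counted.isZeroVec (y i)).bind Counted.touch).bind fun z =>
    Counted.pure ⟨fun _ => 0, y, Finset.univ.filter fun i => z i = false⟩

open Classical in
/-- Look up a normalised vector in the table of the group `i`, which stores, for every edge
`(e, p)` ending at `i`, the weight vector of the edge divided by the sum of its entries. The
result is an edge with this entry, if there is one. One probe per coordinate of the key. -/
noncomputable def lookup (A : Design E μ R M) (i : Fin μ) (key : Fin R → ℝ) :
    Counted (Option (E × Fin 3)) :=
  ⟨if h : ∃ q : E × Fin 3, A.nbr q.1 q.2 = i ∧
      ∀ r, key r = (A.weight q.1 q.2 r : ℝ) / ∑ r', (A.weight q.1 q.2 r' : ℝ)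
    then some h.choose else none, R⟩

/-- Is the residual of the group `i` a non-zero multiple of the weight vector of one single edge
at `i`? If so, return that edge and the multiple. -/
noncomputable def identify (A : Design E μ R M) (i : Fin μ) (y : Fin R → ℝ) :
    Counted (Option ((E × Fin 3) × ℝ)) :=
  (Counted.sum y).bind fun σ => (Counted.isZero σ).bind fun b =>
    if b = true then Counted.pure none
    else (Counted.all fun r => Counted.div (y r) σ).bind fun key =>
      (lookup A i key).bind fun o =>
        match o with
        | none => Counted.pure none
        | some q => (Counted.sum fun r => (A.weight q.1 q.2 r : ℝ)).bind fun s =>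
            (Counted.div σ s).bind fun δ => Counted.pure (some (q, δ))

/-- Cancel the contribution of the delay `δ` at `e` from its `p`-th neighbouring group. -/
noncomputable def cancel (A : Design E μ R M) (e : E) (δ : ℝ) (p : Fin 3) (s : State E μ R) :
    Counted (State E μ R) :=
  (Counted.all fun r => (Counted.mul δ (A.weight e p r)).bind fun t =>
      Counted.sub (s.res (A.nbr e p) r) t).bind fun z =>
    (Counted.isZeroVec z).bind fun b =>
      Counted.touch
        { s with
          res := Function.update s.res (A.nbr e p) z
          active := if b = true then s.active.erase (A.nbr e p)
            else insert (A.nbr e p) s.active }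

/-- One iteration, at the group `i`: if a single link is identified, add its value to the
reconstruction vector and cancel its contribution; otherwise leave everything as it is. -/
noncomputable def step [DecidableEq E] (A : Design E μ R M) (i : Fin μ) (s : State E μ R) :
    Counted (State E μ R) :=
  (identify A i (s.res i)).bind fun o =>
    match o with
    | none => Counted.pure s
    | some (q, δ) =>
        (Counted.add (s.dhat q.1) δ).bind fun x =>
          (cancel A q.1 δ 0 { s with dhat := Function.update s.dhat q.1 x }).bind fun s₁ =>
            (cancel A q.1 δ 1 s₁).bind fun s₂ => cancel A q.1 δ 2 s₂

/-- At most `T` iterations, each at a group drawn uniformly at random from the active ones;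
stop as soon as no group is active, that is, when the residual is zero. -/
noncomputable def peel [DecidableEq E] (A : Design E μ R M) :
    ℕ → State E μ R → PMF (Counted (State E μ R))
  | 0, s => PMF.pure (Counted.pure s)
  | T + 1, s =>
      if h : s.active.Nonempty then
        (PMF.uniformOfFinset s.active h).bind fun i =>
          (peel A T (step A i s).val).map fun x => ⟨x.val, 2 + (step A i s).ops + x.ops⟩
      else PMF.pure ⟨s, 1⟩

/-- The decoder. Input: the end-to-end delays `p i r` of the spanning paths and `q i r` of the
weighted paths. Output: the reconstructed delay vector with the number of operations. -/
noncomputable def decode [DecidableEq E] (A : Design E μ R M) (T : ℕ)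
    (p q : Fin μ → Fin R → ℝ) : PMF (Counted (E → ℝ)) :=
  let y : Counted (Fin μ → Fin R → ℝ) :=
    Counted.all fun i => Counted.all fun r =>
      (Counted.sub (q i r) (p i r)).bind fun t => Counted.div t 2
  let s : Counted (State E μ R) := y.bind (initState E)
  (peel A T s.val).map fun x => ⟨x.val.dhat, s.ops + x.ops⟩

end Decoder

/-! ## The tomography scheme -/

section Scheme

variable {V : Type*} [Fintype V] [DecidableEq V] {G : SimpleGraph V} [DecidableRel G.Adj]
  {μ R M : ℕ}

/-- The spanning path of the row `(i, r)`. -/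
noncomputable def pathP (hG : G.Connected) (A : Design G.edgeSet μ R M) (i : Fin μ) (r : Fin R) :
    NetPath G :=
  spanningPath hG (A.matrix (i, r))

/-- The weighted path of the row `(i, r)`. -/
noncomputable def pathQ (hG : G.Connected) (A : Design G.edgeSet μ R M) (i : Fin μ) (r : Fin R) :
    NetPath G :=
  weightedPath (A.matrix (i, r)) (pathP hG A i r)

/-- The test packets: two for each row. -/
noncomputable def packet (hG : G.Connected) (A : Design G.edgeSet μ R M)
    (x : Fin μ × Fin R × Bool) : NetPath G :=
  if x.2.2 = true then pathQ hG A x.1 x.2.1 else pathP hG A x.1 x.2.1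

/-- FRANTIC with `μ` groups of `R` rows, weights at most `M`, and at most `T` decoding iterations,
on a network with link delays `d`: draw the design, measure the end-to-end delays of the
paths, decode. -/
noncomputable def frantic (hG : G.Connected) (μ R M T : ℕ) [Nonempty (Design G.edgeSet μ R M)]
    (d : G.edgeSet → ℝ) : PMF (Counted (G.edgeSet → ℝ)) :=
  (ensemble G.edgeSet μ R M).bind fun A =>
    decode A T (fun i r => (pathP hG A i r).delay d) (fun i r => (pathQ hG A i r).delay d)

end Scheme

end Frantic

/-! Write a = ρk and let S be the support of d. Since Q crosses each link e exactly 2a_e times more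
often than P, half the difference of the two delays is the corresponding row of A applied to d.
Recovery is therefore a statement about a random sparse matrix, and two properties of the design
suffice.

`Expanding`: every B ⊆ S has at least 2|B| neighbouring groups. Failure means that some B of size s
has all its neighbours inside a set of 2s − 1 groups; as μ ≥ 250|S|, a union bound makes this O(1/μ)
(`freq_not_expanding_le`).

`Generic`: no partial sum of columns of S in a group imitates a further column. Once all other
weights are fixed, at most one primitive vector is parallel to a given residual, so each coincidence
has probability at most 1/N, where N is the number of primitive vectors still available. For R = 6ℓ
one has N > n³, while the union bound costs 9nμ (`freq_not_generic_le`).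

When both hold, the active groups are exactly the neighbours of the set B of unresolved columns. A
group with two or more unresolved columns is never mistaken for one with a single column, and a
group with exactly one (a leaf) reveals it correctly. Counting the 3|B| edges twice shows that at
least a third of the active groups are leaves, so the potential 2^|B| decreases on average by a
factor 5/6 per iteration. Failure within T iterations has probability at most 2^|S| (5/6)^T
(`Remaining.peel_success`), which is at most 1/a for the chosen T.

A packet of group i has O(D·deg i) links and O(DM·deg i) hops, where deg i counts the links having i
as a neighbour. This degree is a sum of independent indicators with mean at most 6n/μ, which gives
the expectation bound directly and the tail by a Chernoff bound. The operation count is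
deterministic: every iteration costs O(R). -/

namespace Frantic

/-! ## Averages over finite types -/

section Mean

variable {Ω Ω' ι : Type*} [Fintype Ω] [Fintype Ω']

/-- The average of a function on a finite type. -/
noncomputable def mean (f : Ω → ℝ) : ℝ := (∑ x, f x) / Fintype.card Ω

open Classical in
/-- The proportion of the elements of a finite type that have a property. -/
noncomputable def freq (p : Ω → Prop) : ℝ := mean fun x => if p x then 1 else 0

lemma mean_mono {f g : Ω → ℝ} (h : ∀ x, f x ≤ g x) : mean f ≤ mean g :=
  div_le_div_of_nonneg_right (Finset.sum_le_sum fun x _ => h x) (Nat.cast_nonneg _)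

lemma mean_nonneg {f : Ω → ℝ} (h : ∀ x, 0 ≤ f x) : 0 ≤ mean f :=
  div_nonneg (Finset.sum_nonneg fun x _ => h x) (Nat.cast_nonneg _)

lemma mean_sum (s : Finset ι) (f : ι → Ω → ℝ) :
    (mean fun x => ∑ i ∈ s, f i x) = ∑ i ∈ s, mean (f i) := by
  simp only [mean, ← Finset.sum_div]
  rw [Finset.sum_comm]

lemma mean_add (f g : Ω → ℝ) : (mean fun x => f x + g x) = mean f + mean g := by
  simp only [mean, Finset.sum_add_distrib, add_div]

lemma mean_const_mul (c : ℝ) (f : Ω → ℝ) : (mean fun x => c * f x) = c * mean f := by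
  simp only [mean, ← Finset.mul_sum, mul_div_assoc]

lemma mean_const [Nonempty Ω] (c : ℝ) : (mean fun _ : Ω => c) = c := by
  have : (Fintype.card Ω : ℝ) ≠ 0 := Nat.cast_ne_zero.2 Fintype.card_ne_zero
  simp [mean, this]

lemma mean_sub (f g : Ω → ℝ) : (mean fun x => f x - g x) = mean f - mean g := by
  simp only [mean, Finset.sum_sub_distrib, sub_div]

lemma mean_prod (f : Ω × Ω' → ℝ) : mean f = mean fun a => mean fun b => f (a, b) := by
  simp only [mean, Fintype.sum_prod_type, Fintype.card_prod, Nat.cast_mul, ← Finset.sum_div,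
    div_div]
  rw [mul_comm]

lemma mean_fst [Nonempty Ω'] (f : Ω → ℝ) : (mean fun x : Ω × Ω' => f x.1) = mean f := by
  rw [mean_prod]
  simp only [mean_const]

lemma freq_nonneg (p : Ω → Prop) : 0 ≤ freq p :=
  mean_nonneg fun x => by split_ifs <;> norm_num

lemma freq_mono {p q : Ω → Prop} (h : ∀ x, p x → q x) : freq p ≤ freq q :=
  mean_mono fun x => by
    by_cases hp : p x
    · simp [hp, h x hp]
    · simp only [hp, if_false]; split_ifs <;> norm_num

lemma freq_or_le (p q : Ω → Prop) : freq (fun x => p x ∨ q x) ≤ freq p + freq q := by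
  unfold freq
  rw [← mean_add]
  refine mean_mono fun x => ?_
  by_cases hp : p x <;> by_cases hq : q x <;> simp [hp, hq]

open Classical in
lemma freq_exists_le (s : Finset ι) (p : ι → Ω → Prop) :
    freq (fun x => ∃ i ∈ s, p i x) ≤ ∑ i ∈ s, freq (p i) := by
  unfold freq
  rw [← mean_sum]
  refine mean_mono fun x => ?_
  split_ifs with h
  · obtain ⟨i, hi, hp⟩ := h
    refine le_trans (by simp [hp])
      (Finset.single_le_sum (f := fun i => if p i x then (1 : ℝ) else 0) (fun j _ => ?_) hi)
    split_ifs <;> norm_num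
  · exact Finset.sum_nonneg fun j _ => by split_ifs <;> norm_num

lemma freq_not [Nonempty Ω] (p : Ω → Prop) : freq (fun x => ¬ p x) = 1 - freq p := by
  unfold freq
  rw [← mean_const (Ω := Ω) (1 : ℝ), ← mean_sub]
  congr 1
  funext x
  by_cases h : p x <;> simp [h, mean_const]

open Classical in
lemma freq_fst [Nonempty Ω'] (p : Ω → Prop) : freq (fun x : Ω × Ω' => p x.1) = freq p := by
  unfold freq
  exact mean_fst fun a => if p a then (1 : ℝ) else 0

lemma freq_prod (p : Ω × Ω' → Prop) : freq p = mean fun a => freq fun b => p (a, b) := by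
  unfold freq
  rw [mean_prod]

lemma freq_eq_card (p : Ω → Prop) [DecidablePred p] :
    freq p = ((Finset.univ.filter p).card : ℝ) / Fintype.card Ω := by
  unfold freq mean
  rw [← Finset.sum_boole]
  congr!

/-- Markov's inequality. -/
lemma freq_lt_mul_le (f : Ω → ℝ) (hf : ∀ x, 0 ≤ f x) (c : ℝ) :
    freq (fun x => c < f x) * c ≤ mean f := by
  unfold freq
  rw [mul_comm, ← mean_const_mul]
  refine mean_mono fun x => ?_
  split_ifs with h
  · linarith
  · simpa using hf x

open Classical in
lemma uniform_toOuterMeasure [Nonempty Ω] (s : Set Ω) :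
    (PMF.uniformOfFintype Ω).toOuterMeasure s = ENNReal.ofReal (freq fun x => x ∈ s) := by
  have h : (0 : ℝ) < Fintype.card Ω := Nat.cast_pos.2 Fintype.card_pos
  rw [PMF.toOuterMeasure_uniformOfFintype_apply, freq_eq_card, ENNReal.ofReal_div_of_pos h,
    ENNReal.ofReal_natCast, ENNReal.ofReal_natCast, ← Set.toFinset_card]
  congr 3
  ext x
  simp

/-- Independent coordinates: the average of a product of functions of single coordinates. -/
lemma mean_prod_coord {E : Type*} [Fintype E] [DecidableEq E] [Nonempty Ω] (B : Finset E)
    (F : Ω → ℝ) : (mean fun g : E → Ω => ∏ e ∈ B, F (g e)) = mean F ^ B.card := by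
  have h0 : (Fintype.card Ω : ℝ) ≠ 0 := Nat.cast_ne_zero.2 Fintype.card_ne_zero
  have h1 : ∀ g : E → Ω, ∏ e ∈ B, F (g e) = ∏ e, if e ∈ B then F (g e) else 1 := by
    intro g
    rw [Finset.prod_ite_mem, Finset.univ_inter]
  have h2 := Finset.prod_univ_sum (fun _ : E => (Finset.univ : Finset Ω))
    (fun e x => if e ∈ B then F x else (1 : ℝ))
  rw [Fintype.piFinset_univ] at h2
  unfold mean
  simp only [h1]
  rw [← h2]
  have h3 : ∀ e : E, (∑ x : Ω, if e ∈ B then F x else (1 : ℝ)) =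
      (if e ∈ B then mean F else 1) * Fintype.card Ω := by
    intro e
    by_cases he : e ∈ B
    · simp [he, mean, h0]
    · simp [he]
  simp only [h3]
  rw [Finset.prod_mul_distrib, Finset.prod_ite_mem, Finset.univ_inter, Finset.prod_const,
    Finset.prod_const, Finset.card_univ, Fintype.card_fun, Nat.cast_pow, mul_div_assoc,
    div_self (pow_ne_zero _ h0), mul_one]
  rfl

lemma mean_coord {E : Type*} [Fintype E] [DecidableEq E] [Nonempty Ω] (e : E)
    (F : Ω → ℝ) : (mean fun g : E → Ω => F (g e)) = mean F := by
  simpa using mean_prod_coord {e} F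

end Mean

/-! ## Uniformly random embeddings -/

section Embedding

/-- If the value of an embedding at `q` is determined by its other values, then this happens
for a small proportion of the embeddings only. -/
lemma freq_embedding_determined_le {α β : Type*} [Fintype α] [DecidableEq α] [Fintype β]
    [DecidableEq β] (q : α) (h : Fintype.card α ≤ Fintype.card β) (p : (α ↪ β) → Prop)
    (hp : ∀ w w', p w → p w' → (∀ x, x ≠ q → w x = w' x) → w q = w' q) :
    freq p ≤ 1 / ((Fintype.card β : ℝ) - Fintype.card α + 1) := by
  classical
  have hα : 0 < Fintype.card α := Fintype.card_pos_iff.2 ⟨q⟩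
  obtain ⟨m, hm⟩ : ∃ m, Fintype.card α = m + 1 := ⟨Fintype.card α - 1, by omega⟩
  have hsub : Fintype.card {x // x ≠ q} = m := by
    rw [Fintype.card_subtype_compl, Fintype.card_subtype_eq, hm]; rfl
  -- Restriction to the points other than `q` is injective on the embeddings with property `p`, so
  -- there are at most as many as embeddings of `m` points. Dividing by the number of embeddings of
  -- `m + 1` points leaves the last factor |β| − m of the descending factorial.
  have hle : (Finset.univ.filter p).card ≤ Fintype.card ({x // x ≠ q} ↪ β) := by
    refine Finset.card_le_card_of_injOn
      (fun w => (Function.Embedding.subtype fun x => x ≠ q).trans w)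
      (fun _ _ => Finset.mem_univ _) ?_
    intro w hw w' hw' heq
    simp only [Finset.coe_filter, Finset.mem_univ, true_and, Set.mem_ofPred_eq] at hw hw'
    have hoff : ∀ x, x ≠ q → w x = w' x := fun x hx => DFunLike.congr_fun heq ⟨x, hx⟩
    ext x
    by_cases hx : x = q
    · subst hx; exact hp w w' hw hw' hoff
    · exact hoff x hx
  rw [freq_eq_card]
  rw [Fintype.card_embedding_eq, hsub] at hle
  rw [Fintype.card_embedding_eq, hm, Nat.descFactorial_succ]
  have hpos : 0 < (Fintype.card β).descFactorial m := Nat.descFactorial_pos.2 (by omega)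
  have hcast : ((Fintype.card β - m : ℕ) : ℝ) = (Fintype.card β : ℝ) - (m + 1 : ℕ) + 1 := by
    rw [Nat.cast_sub (by omega)]; push_cast; ring
  have hpos' : (0 : ℝ) < (Fintype.card β : ℝ) - (m + 1 : ℕ) + 1 := by
    rw [← hcast]; exact Nat.cast_pos.2 (by omega)
  rw [Nat.cast_mul, hcast, div_le_div_iff₀ (mul_pos hpos' (Nat.cast_pos.2 hpos)) hpos', one_mul,
    mul_comm (_ + _ : ℝ)]
  exact mul_le_mul_of_nonneg_right (Nat.cast_le.2 hle) hpos'.le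

variable {μ : ℕ}

lemma nonempty_triple (hμ : 3 ≤ μ) : Nonempty (Fin 3 ↪ Fin μ) :=
  Function.Embedding.nonempty_of_card_le (by simpa using hμ)

/-- The condition `τ p = i` determines the value at `p`, so it has proportion at most 1/(μ − 2),
which is at most 2/μ once μ ≥ 4. The three positions are then added up. -/
lemma freq_triple_mem_le (hμ : 4 ≤ μ) (i : Fin μ) :
    freq (fun τ : Fin 3 ↪ Fin μ => ∃ p, τ p = i) ≤ 6 / μ := by
  have h1 : ∀ p : Fin 3, freq (fun τ : Fin 3 ↪ Fin μ => τ p = i) ≤ 2 / μ := by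
    intro p
    refine (freq_embedding_determined_le p (by simp; omega) _
      fun w w' hw hw' _ => hw.trans hw'.symm).trans ?_
    have hμ' : (4 : ℝ) ≤ μ := by exact_mod_cast hμ
    simp only [Fintype.card_fin]
    rw [div_le_div_iff₀ (by push_cast; linarith) (by linarith)]
    push_cast
    linarith
  calc freq (fun τ : Fin 3 ↪ Fin μ => ∃ p, τ p = i)
      ≤ freq (fun τ : Fin 3 ↪ Fin μ => ∃ p ∈ Finset.univ, τ p = i) :=
        freq_mono fun τ ⟨p, hp⟩ => ⟨p, Finset.mem_univ _, hp⟩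
    _ ≤ ∑ p : Fin 3, freq (fun τ : Fin 3 ↪ Fin μ => τ p = i) := freq_exists_le _ _
    _ ≤ ∑ _p : Fin 3, (2 / μ : ℝ) := Finset.sum_le_sum fun p _ => h1 p
    _ = 6 / μ := by simp; ring

/-- Factor by factor, (t − j)/(m − j) ≤ t/m: drawing without replacement hits a given set no more
often than drawing with replacement. -/
lemma descFactorial_three_mul_le {t m : ℕ} (h : t ≤ m) :
    t.descFactorial 3 * m ^ 3 ≤ t ^ 3 * m.descFactorial 3 := by
  have key : ∀ j, (t - j) * m ≤ t * (m - j) := by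
    intro j
    rw [Nat.sub_mul, Nat.mul_sub]
    have : t * j ≤ j * m := by rw [mul_comm]; exact Nat.mul_le_mul_left _ h
    omega
  have := Nat.mul_le_mul (Nat.mul_le_mul (key 2) (key 1)) (key 0)
  simp only [Nat.descFactorial_succ, Nat.descFactorial_zero]
  calc _ = (t - 2) * m * ((t - 1) * m) * ((t - 0) * m) := by ring
    _ ≤ _ := this
    _ = _ := by ring

lemma freq_triple_subset_le (hμ : 3 ≤ μ) (U : Finset (Fin μ)) :
    freq (fun τ : Fin 3 ↪ Fin μ => ∀ p, τ p ∈ U) ≤ ((U.card : ℝ) / μ) ^ 3 := by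
  classical
  have hle : (Finset.univ.filter fun τ : Fin 3 ↪ Fin μ => ∀ p, τ p ∈ U).card ≤
      Fintype.card (Fin 3 ↪ U) := by
    rw [← Fintype.card_subtype]
    refine Fintype.card_le_of_injective
      (fun τ => (⟨fun p => ⟨τ.1 p, τ.2 p⟩, fun a b h => τ.1.injective (by simpa using h)⟩ :
        Fin 3 ↪ U)) ?_
    intro τ τ' h
    ext p
    have := DFunLike.congr_fun h p
    exact congrArg (fun x : U => (x.1 : ℕ)) this
  rw [freq_eq_card]
  rw [Fintype.card_embedding_eq, Fintype.card_fin, Fintype.card_coe] at hle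
  rw [Fintype.card_embedding_eq, Fintype.card_fin, Fintype.card_fin, div_pow]
  have hd : 0 < μ.descFactorial 3 := Nat.descFactorial_pos.2 hμ
  have hμ' : (0 : ℝ) < (μ : ℝ) ^ 3 := by positivity
  rw [div_le_div_iff₀ (Nat.cast_pos.2 hd) hμ']
  have h3 := descFactorial_three_mul_le (t := U.card) (m := μ) (by simpa using U.card_le_univ)
  calc _ ≤ ((U.card.descFactorial 3 : ℕ) : ℝ) * (μ : ℝ) ^ 3 :=
        mul_le_mul_of_nonneg_right (Nat.cast_le.2 hle) hμ'.le
    _ ≤ _ := by exact_mod_cast h3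

end Embedding

/-! ## Random hypergraphs of triples -/

section Hypergraph

variable {E : Type*} {μ : ℕ}

/-- All groups that are neighbours of a column in `B`. -/
def nbrs (g : E → (Fin 3 ↪ Fin μ)) (B : Finset E) : Finset (Fin μ) :=
  B.biUnion fun e => Finset.univ.map (g e)

lemma mem_nbrs {g : E → (Fin 3 ↪ Fin μ)} {B : Finset E} {i : Fin μ} :
    i ∈ nbrs g B ↔ ∃ e ∈ B, ∃ p, g e p = i := by
  simp [nbrs]

/-- Every subset of `S` has at least twice as many neighbours as elements. -/
def Expanding (g : E → (Fin 3 ↪ Fin μ)) (S : Finset E) : Prop :=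
  ∀ B ⊆ S, 2 * B.card ≤ (nbrs g B).card

variable [Fintype E] [DecidableEq E]

lemma freq_forall_mem_subset_le (hμ : 3 ≤ μ) (B : Finset E) (U : Finset (Fin μ)) :
    freq (fun g : E → (Fin 3 ↪ Fin μ) => ∀ e ∈ B, ∀ p, g e p ∈ U) ≤
      ((U.card : ℝ) / μ) ^ (3 * B.card) := by
  classical
  have := nonempty_triple hμ
  have h := mean_prod_coord B fun τ : Fin 3 ↪ Fin μ => if ∀ p, τ p ∈ U then (1 : ℝ) else 0
  have h2 : freq (fun g : E → (Fin 3 ↪ Fin μ) => ∀ e ∈ B, ∀ p, g e p ∈ U) =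
      freq (fun τ : Fin 3 ↪ Fin μ => ∀ p, τ p ∈ U) ^ B.card := by
    have h3 : mean (fun τ : Fin 3 ↪ Fin μ => if ∀ p, τ p ∈ U then (1 : ℝ) else 0) =
        freq (fun τ : Fin 3 ↪ Fin μ => ∀ p, τ p ∈ U) := by
      unfold freq; congr!
    rw [← h3, ← h]
    unfold freq
    congr 1
    funext g
    rw [Finset.prod_boole]
    congr!
  rw [h2, pow_mul]
  exact pow_le_pow_left₀ (freq_nonneg _) (freq_triple_subset_le hμ U) _

/-- A weak Stirling bound: s^s/s! is one term of the series of e^s, and e < 3. -/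
lemma self_pow_le_factorial_mul (s : ℕ) : (s : ℝ) ^ s ≤ 3 ^ s * s.factorial := by
  have h := Real.pow_div_factorial_le_exp (s : ℝ) (Nat.cast_nonneg s) s
  rw [div_le_iff₀ (by positivity)] at h
  refine h.trans (mul_le_mul_of_nonneg_right ?_ (by positivity))
  rw [← Real.exp_one_pow]
  exact pow_le_pow_left₀ (Real.exp_pos 1).le (by linarith [Real.exp_one_lt_d9]) _

/-- The term of the union bound for sets of size s, with t = 2s − 1. The exponent 3s is split as t +
(s + 1): the part t cancels μ^t against t!, and the part s + 1 pairs s factors with k^s and leaves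
one spare factor 2s/μ, the source of the 1/μ. The constants combine to 3·9·2 = 54, and 54k/μ ≤ 1/4
follows from μ ≥ 250k. -/
lemma choose_mul_choose_mul_pow_le {k s : ℕ} (hs : 1 ≤ s) (hsk : s ≤ k) (hμ : 250 * k ≤ μ) :
    (k.choose s : ℝ) * (μ.choose (2 * s - 1)) * (((2 * s - 1 : ℕ) : ℝ) / μ) ^ (3 * s) ≤
      2 / μ * (1 / 2) ^ s := by
  obtain ⟨t, ht⟩ : ∃ t, t = 2 * s - 1 := ⟨_, rfl⟩
  rw [← ht]
  have h3 : 3 * s = t + (s + 1) := by omega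
  have hμ0 : (0 : ℝ) < μ := Nat.cast_pos.2 (by omega)
  have hs0 : (0 : ℝ) < s := Nat.cast_pos.2 (by omega)
  have hc1 : (k.choose s : ℝ) ≤ (k : ℝ) ^ s / s.factorial := Nat.choose_le_pow_div s k
  have hc2 : (μ.choose t : ℝ) ≤ (μ : ℝ) ^ t / t.factorial := Nat.choose_le_pow_div t μ
  have ht2 : (t : ℝ) ≤ 2 * s := by
    have : t ≤ 2 * s := by omega
    exact_mod_cast this
  have hA : (k : ℝ) ^ s / s.factorial ≤ 3 ^ s * (k / s) ^ s := by
    rw [div_pow, div_le_iff₀ (by positivity)]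
    have := self_pow_le_factorial_mul s
    calc (k : ℝ) ^ s = (k : ℝ) ^ s / s ^ s * s ^ s := by field_simp
      _ ≤ (k : ℝ) ^ s / s ^ s * (3 ^ s * s.factorial) := by gcongr
      _ = _ := by ring
  have hB : (μ : ℝ) ^ t / t.factorial * ((t : ℝ) / μ) ^ t ≤ 9 ^ s := by
    have h1 : (μ : ℝ) ^ t / t.factorial * ((t : ℝ) / μ) ^ t = (t : ℝ) ^ t / t.factorial := by
      rw [div_pow]; field_simp
    rw [h1, div_le_iff₀ (by positivity)]
    refine (self_pow_le_factorial_mul t).trans ?_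
    gcongr
    calc (3 : ℝ) ^ t ≤ 3 ^ (2 * s) := pow_le_pow_right₀ (by norm_num) (by omega)
      _ = 9 ^ s := by rw [pow_mul]; norm_num
  have hC : ((t : ℝ) / μ) ^ (s + 1) ≤ (2 * s / μ) ^ (s + 1) := by gcongr
  have hq : 54 * (k : ℝ) / μ ≤ 1 / 4 := by
    rw [div_le_iff₀ hμ0]
    have : (250 : ℝ) * k ≤ μ := by exact_mod_cast hμ
    nlinarith [(Nat.cast_nonneg k : (0 : ℝ) ≤ k)]
  have h2s : (s : ℝ) ≤ 2 ^ s := by exact_mod_cast Nat.lt_two_pow_self.le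
  calc (k.choose s : ℝ) * (μ.choose t) * ((t : ℝ) / μ) ^ (3 * s)
      ≤ ((k : ℝ) ^ s / s.factorial) * ((μ : ℝ) ^ t / t.factorial) * ((t : ℝ) / μ) ^ (3 * s) := by
        gcongr
    _ = ((k : ℝ) ^ s / s.factorial) * ((μ : ℝ) ^ t / t.factorial * ((t : ℝ) / μ) ^ t) *
          ((t : ℝ) / μ) ^ (s + 1) := by rw [h3, pow_add]; ring
    _ ≤ (3 ^ s * (k / s) ^ s) * 9 ^ s * (2 * s / μ) ^ (s + 1) := by gcongr
    _ = (54 * k / μ) ^ s * (2 * s / μ) := by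
        rw [pow_succ, ← mul_assoc, ← mul_pow, ← mul_pow, ← mul_pow]
        congr 2
        field_simp
        ring
    _ ≤ (1 / 4) ^ s * (2 * 2 ^ s / μ) := by gcongr
    _ = 2 / μ * (1 / 2) ^ s := by
        have : (1 / 4 : ℝ) ^ s = (1 / 2) ^ s * (1 / 2) ^ s := by rw [← mul_pow]; norm_num
        rw [this]
        have h2 : (1 / 2 : ℝ) ^ s * 2 ^ s = 1 := by rw [← mul_pow]; norm_num
        calc _ = 2 / μ * (1 / 2) ^ s * ((1 / 2 : ℝ) ^ s * 2 ^ s) := by ring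
          _ = _ := by rw [h2, mul_one]

lemma sum_Icc_half_pow_le (k : ℕ) : ∑ s ∈ Finset.Icc 1 k, (1 / 2 : ℝ) ^ s ≤ 2 :=
  calc ∑ s ∈ Finset.Icc 1 k, (1 / 2 : ℝ) ^ s ≤ ∑' s : ℕ, (1 / 2 : ℝ) ^ s :=
        summable_geometric_two.sum_le_tsum _ fun _ _ => by positivity
    _ = 2 := tsum_geometric_two

/-- A sparse random hypergraph is expanding with high probability. -/
lemma freq_not_expanding_le (hμ3 : 3 ≤ μ) (S : Finset E) (hμ : 250 * S.card ≤ μ) :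
    freq (fun g : E → (Fin 3 ↪ Fin μ) => ¬ Expanding g S) ≤ 4 / μ := by
  set k := S.card with hk
  have hμ0 : (0 : ℝ) < μ := Nat.cast_pos.2 (by omega)
  calc freq (fun g : E → (Fin 3 ↪ Fin μ) => ¬ Expanding g S)
      ≤ freq (fun g : E → (Fin 3 ↪ Fin μ) => ∃ s ∈ Finset.Icc 1 k, ∃ B ∈ S.powersetCard s,
          ∃ U ∈ (Finset.univ : Finset (Fin μ)).powersetCard (2 * s - 1),
            ∀ e ∈ B, ∀ p, g e p ∈ U) := by
        refine freq_mono fun g hg => ?_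
        simp only [Expanding, not_forall, not_le] at hg
        obtain ⟨B, hB, hlt⟩ := hg
        have hBk : B.card ≤ k := Finset.card_le_card hB
        -- The neighbourhood may be smaller; enlarging it to exactly 2s − 1 groups leaves a single
        -- size of `U` per s in the union bound.
        obtain ⟨U, hU, hUc⟩ := Finset.exists_superset_card_eq (s := nbrs g B)
          (n := 2 * B.card - 1) (by omega) (by simp; omega)
        refine ⟨B.card, Finset.mem_Icc.2 ⟨by omega, hBk⟩, B, Finset.mem_powersetCard.2 ⟨hB, rfl⟩,
          U, Finset.mem_powersetCard.2 ⟨Finset.subset_univ _, hUc⟩, fun e he p => hU ?_⟩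
        exact mem_nbrs.2 ⟨e, he, p, rfl⟩
    _ ≤ ∑ s ∈ Finset.Icc 1 k, ∑ B ∈ S.powersetCard s,
          ∑ U ∈ (Finset.univ : Finset (Fin μ)).powersetCard (2 * s - 1),
            (((2 * s - 1 : ℕ) : ℝ) / μ) ^ (3 * s) := by
        refine (freq_exists_le _ _).trans (Finset.sum_le_sum fun s _ => ?_)
        refine (freq_exists_le _ _).trans (Finset.sum_le_sum fun B hB => ?_)
        refine (freq_exists_le _ _).trans (Finset.sum_le_sum fun U hU => ?_)
        have := freq_forall_mem_subset_le hμ3 B U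
        rwa [(Finset.mem_powersetCard.1 hB).2, (Finset.mem_powersetCard.1 hU).2] at this
    _ ≤ ∑ s ∈ Finset.Icc 1 k, (2 / μ * (1 / 2) ^ s : ℝ) := by
        refine Finset.sum_le_sum fun s hs => ?_
        rw [Finset.mem_Icc] at hs
        simp only [Finset.sum_const, Finset.card_powersetCard, nsmul_eq_mul, Finset.card_univ,
          Fintype.card_fin]
        rw [← mul_assoc]
        exact choose_mul_choose_mul_pow_le hs.1 hs.2 hμ
    _ ≤ 2 / μ * 2 := by
        rw [← Finset.mul_sum]
        exact mul_le_mul_of_nonneg_left (sum_Icc_half_pow_le k) (by positivity)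
    _ = 4 / μ := by ring

/-- The columns in `B` that have the group `i` as a neighbour. -/
def incident (g : E → (Fin 3 ↪ Fin μ)) (B : Finset E) (i : Fin μ) : Finset E :=
  B.filter fun e => ∃ p, g e p = i

/-- The moment generating function of the degree of a group. -/
lemma mean_pow_card_incident_le (hμ : 4 ≤ μ) (B : Finset E) (i : Fin μ) {t : ℝ} (ht : 1 ≤ t) :
    mean (fun g : E → (Fin 3 ↪ Fin μ) => t ^ (incident g B i).card) ≤
      Real.exp ((t - 1) * (6 / μ) * B.card) := by
  classical
  have := nonempty_triple (μ := μ) (by omega)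
  have h := mean_prod_coord B fun τ : Fin 3 ↪ Fin μ => if ∃ p, τ p = i then t else 1
  have h1 : mean (fun τ : Fin 3 ↪ Fin μ => if ∃ p, τ p = i then t else 1) ≤
      Real.exp ((t - 1) * (6 / μ)) := by
    calc mean (fun τ : Fin 3 ↪ Fin μ => if ∃ p, τ p = i then t else 1)
        = mean (fun τ : Fin 3 ↪ Fin μ => 1 + (t - 1) * if ∃ p, τ p = i then (1 : ℝ) else 0) := by
          congr 1
          funext τ
          split_ifs <;> ring
      _ = 1 + (t - 1) * freq (fun τ : Fin 3 ↪ Fin μ => ∃ p, τ p = i) := by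
          rw [mean_add, mean_const, mean_const_mul]
          unfold freq
          congr!
      _ ≤ 1 + (t - 1) * (6 / μ) := by
          have := freq_triple_mem_le hμ i
          gcongr
      -- The inequality 1 + x ≤ e^x makes the product over the independent columns a single
      -- exponential.
      _ ≤ _ := by linarith [Real.add_one_le_exp ((t - 1) * (6 / (μ : ℝ)))]
  calc mean (fun g : E → (Fin 3 ↪ Fin μ) => t ^ (incident g B i).card)
      = mean (fun g : E → (Fin 3 ↪ Fin μ) => ∏ e ∈ B, if ∃ p, g e p = i then t else 1) := by
        congr 1
        funext g
        rw [Finset.prod_ite, Finset.prod_const_one, mul_one, Finset.prod_const, incident]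
    _ = _ := h
    _ ≤ Real.exp ((t - 1) * (6 / μ)) ^ B.card := by
        refine pow_le_pow_left₀ (mean_nonneg fun τ => ?_) h1 _
        split_ifs <;> linarith
    _ = _ := by rw [← Real.exp_nat_mul]; ring_nf

lemma mean_card_incident_le (hμ : 4 ≤ μ) (B : Finset E) (i : Fin μ) :
    mean (fun g : E → (Fin 3 ↪ Fin μ) => ((incident g B i).card : ℝ)) ≤ 6 / μ * B.card := by
  classical
  have := nonempty_triple (μ := μ) (by omega)
  simp only [incident, ← Finset.sum_boole (R := ℝ)]
  rw [mean_sum]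
  calc _ ≤ ∑ e ∈ B, (6 / μ : ℝ) := by
        refine Finset.sum_le_sum fun e _ => ?_
        have h := mean_coord e fun τ : Fin 3 ↪ Fin μ => if ∃ p, τ p = i then (1 : ℝ) else 0
        rw [h]
        refine le_trans (le_of_eq ?_) (freq_triple_mem_le hμ i)
        unfold freq
        congr!
    _ = _ := by simp [mul_comm]

/-- Chernoff bound with base t = 3: the mean of 3^deg is at most exp(12|B|/μ), and because e < 3 the
event deg > x forces 3^deg > e^x. -/
lemma freq_lt_card_incident_le (hμ : 4 ≤ μ) (B : Finset E) (i : Fin μ) {m x : ℝ}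
    (hx : 12 / μ * B.card + m ≤ x) :
    freq (fun g : E → (Fin 3 ↪ Fin μ) => x < (incident g B i).card) ≤ Real.exp (-m) := by
  have h1 := freq_lt_mul_le (fun g : E → (Fin 3 ↪ Fin μ) => (3 : ℝ) ^ (incident g B i).card)
    (fun g => by positivity) (Real.exp x)
  have h2 := mean_pow_card_incident_le hμ B i (t := 3) (by norm_num)
  have h3 : freq (fun g : E → (Fin 3 ↪ Fin μ) => x < (incident g B i).card) ≤
      freq (fun g : E → (Fin 3 ↪ Fin μ) => Real.exp x < (3 : ℝ) ^ (incident g B i).card) := by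
    refine freq_mono fun g hg => (Real.exp_lt_exp.2 hg).trans_le ?_
    rw [← Real.exp_one_pow]
    exact pow_le_pow_left₀ (Real.exp_pos 1).le (by linarith [Real.exp_one_lt_d9]) _
  have h4 := (mul_le_mul_of_nonneg_right h3 (Real.exp_pos x).le).trans (h1.trans h2)
  rw [← le_div_iff₀ (Real.exp_pos x), ← Real.exp_sub] at h4
  refine h4.trans (Real.exp_le_exp.2 ?_)
  have : (3 - 1) * (6 / μ) * B.card = (12 / μ * B.card : ℝ) := by ring
  linarith

end Hypergraph

/-! ## Primitive vectors -/

section Primitive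

variable {M R : ℕ}

lemma card_Icc_filter_dvd (M m : ℕ) :
    Fintype.card {c : ↥(Finset.Icc 1 M) // m ∣ (c : ℕ)} = M / m := by
  rw [← Nat.Ioc_filter_dvd_card_eq_div M m, ← Fintype.card_coe]
  refine Fintype.card_congr ⟨fun c => ⟨c.1, ?_⟩, fun c => ⟨⟨c.1, ?_⟩, ?_⟩, fun c => rfl, fun c => rfl⟩
  · have h := Finset.mem_Icc.1 c.1.2
    exact Finset.mem_filter.2 ⟨Finset.mem_Ioc.2 ⟨h.1, h.2⟩, c.2⟩
  · have h := Finset.mem_Ioc.1 (Finset.mem_filter.1 c.2).1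
    exact Finset.mem_Icc.2 ⟨h.1, h.2⟩
  · exact (Finset.mem_filter.1 c.2).2

/-- Telescoping: 1/m³ ≤ ½(1/(m − 1) − 1/m). The strengthened form `h1` is what the induction
carries. -/
lemma sum_one_div_pow_le (M : ℕ) (hR : 3 ≤ R) :
    ∑ m ∈ Finset.Icc 2 M, (1 / (m : ℝ)) ^ R ≤ 1 / 2 := by
  have h1 : ∀ N : ℕ, ∑ m ∈ Finset.Icc 2 (N + 1), (1 / (m : ℝ)) ^ R ≤
      1 / 2 * (1 - 1 / ((N : ℝ) + 1)) := by
    intro N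
    induction N with
    | zero => simp
    | succ N ih =>
      rw [Finset.sum_Icc_succ_top (by omega)]
      have h2 : (1 / ((N + 1 + 1 : ℕ) : ℝ)) ^ R ≤ (1 / ((N + 1 + 1 : ℕ) : ℝ)) ^ 3 :=
        pow_le_pow_of_le_one (by positivity)
          (by rw [div_le_one (by positivity)]; push_cast; linarith [(Nat.cast_nonneg N : (0:ℝ) ≤ N)]) hR
      have h3 : (1 / ((N + 1 + 1 : ℕ) : ℝ)) ^ 3 ≤
          1 / 2 * (1 / ((N : ℝ) + 1) - 1 / ((N : ℝ) + 1 + 1)) := by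
        push_cast
        have hN : (0 : ℝ) ≤ N := Nat.cast_nonneg N
        rw [div_sub_div _ _ (by positivity) (by positivity), div_pow, one_pow, ← mul_div_assoc,
          div_le_div_iff₀ (by positivity) (by positivity)]
        nlinarith [mul_nonneg hN hN, mul_nonneg (mul_nonneg hN hN) hN]
      push_cast at h2 h3 ⊢
      linarith
  rcases M with _ | N
  · simp
  · refine (h1 N).trans ?_
    have : (0 : ℝ) ≤ 1 / ((N : ℝ) + 1) := by positivity
    linarith

/-- A vector that is not primitive has a common divisor m with 2 ≤ m ≤ M, and at most (M/m)^R
vectors are divisible by m. The sum of m^(−R) over these m is at most 1/2, so at least half of all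
vectors are primitive. -/
lemma pow_le_two_mul_card_primVec (hR : 3 ≤ R) :
    (M : ℝ) ^ R ≤ 2 * Fintype.card (PrimVec M R) := by
  classical
  have htot : Fintype.card (Fin R → ↥(Finset.Icc 1 M)) = M ^ R := by simp
  have hcompl : Fintype.card (PrimVec M R) + (Finset.univ.filter
      fun c : Fin R → ↥(Finset.Icc 1 M) => ¬ (Finset.univ.gcd fun r => (c r : ℕ)) = 1).card =
      M ^ R := by
    rw [← htot, Fintype.card_subtype, Finset.card_filter_add_card_filter_not, Finset.card_univ]
  have hsub : (Finset.univ.filter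
      fun c : Fin R → ↥(Finset.Icc 1 M) => ¬ (Finset.univ.gcd fun r => (c r : ℕ)) = 1) ⊆
      (Finset.Icc 2 M).biUnion fun m => Finset.univ.filter fun c => ∀ r, m ∣ (c r : ℕ) := by
    intro c hc
    have hc1 := (Finset.mem_filter.1 hc).2
    have hdvd : ∀ r, (Finset.univ.gcd fun r => (c r : ℕ)) ∣ (c r : ℕ) := fun r =>
      Finset.gcd_dvd (Finset.mem_univ r)
    have h0 := Finset.mem_Icc.1 (c ⟨0, by omega⟩).2
    have hle := Nat.le_of_dvd h0.1 (hdvd ⟨0, by omega⟩)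
    have hpos := Nat.pos_of_dvd_of_pos (hdvd ⟨0, by omega⟩) h0.1
    refine Finset.mem_biUnion.2 ⟨_, Finset.mem_Icc.2 ⟨?_, hle.trans h0.2⟩,
      Finset.mem_filter.2 ⟨Finset.mem_univ _, hdvd⟩⟩
    omega
  have hcard : ∀ m, (Finset.univ.filter fun c : Fin R → ↥(Finset.Icc 1 M) =>
      ∀ r, m ∣ (c r : ℕ)).card = (M / m) ^ R := by
    intro m
    rw [← Fintype.card_subtype, ← card_Icc_filter_dvd M m, ← Fintype.card_fin R,
      ← Fintype.card_fun, Fintype.card_fin]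
    exact Fintype.card_congr
      (Equiv.subtypePiEquivPi (p := fun _ (c : ↥(Finset.Icc 1 M)) => m ∣ (c : ℕ)))
  have hbound : ((Finset.univ.filter fun c : Fin R → ↥(Finset.Icc 1 M) =>
      ¬ (Finset.univ.gcd fun r => (c r : ℕ)) = 1).card : ℝ) ≤ (M : ℝ) ^ R * (1 / 2) := by
    calc _ ≤ ((∑ m ∈ Finset.Icc 2 M, (M / m) ^ R : ℕ) : ℝ) := by
          refine Nat.cast_le.2 ((Finset.card_le_card hsub).trans ?_)
          refine Finset.card_biUnion_le.trans (le_of_eq ?_)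
          exact Finset.sum_congr rfl fun m _ => hcard m
      _ ≤ ∑ m ∈ Finset.Icc 2 M, (M : ℝ) ^ R * (1 / (m : ℝ)) ^ R := by
          push_cast
          refine Finset.sum_le_sum fun m _ => ?_
          rw [← mul_pow, mul_one_div]
          exact pow_le_pow_left₀ (Nat.cast_nonneg _) Nat.cast_div_le _
      _ ≤ _ := by
          rw [← Finset.mul_sum]
          exact mul_le_mul_of_nonneg_left (sum_one_div_pow_le M hR) (by positivity)
  have hcompl' := congrArg (Nat.cast : ℕ → ℝ) hcompl
  push_cast at hcompl' hbound
  linarith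

lemma PrimVec.one_le (c : PrimVec M R) (r : Fin R) : 1 ≤ (c.1 r : ℕ) :=
  (Finset.mem_Icc.1 (c.1 r).2).1

lemma PrimVec.le (c : PrimVec M R) (r : Fin R) : (c.1 r : ℕ) ≤ M :=
  (Finset.mem_Icc.1 (c.1 r).2).2

/-- Parallel primitive vectors are equal. -/
lemma PrimVec.eq_of_smul_eq {c c' : PrimVec M R} {t t' : ℝ} (ht : t ≠ 0)
    (h : ∀ r, t * (c.1 r : ℕ) = t' * (c'.1 r : ℕ)) : c = c' := by
  have hcross : ∀ r s, (c.1 r : ℕ) * (c'.1 s : ℕ) = (c'.1 r : ℕ) * (c.1 s : ℕ) := by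
    intro r s
    have h1 : t * (((c.1 r : ℕ) : ℝ) * ((c'.1 s : ℕ) : ℝ)) =
        t * (((c'.1 r : ℕ) : ℝ) * ((c.1 s : ℕ) : ℝ)) := by
      linear_combination ((c'.1 s : ℕ) : ℝ) * h r - ((c'.1 r : ℕ) : ℝ) * h s
    exact_mod_cast mul_left_cancel₀ ht h1
  refine Subtype.ext (funext fun r => Subtype.ext ?_)
  -- Taking the gcd over s in c_r c'_s = c'_r c_s gives c_r · gcd c' = c'_r · gcd c, and both gcds
  -- are 1.
  have h1 := Finset.gcd_mul_left (s := Finset.univ) (f := fun s => (c'.1 s : ℕ)) (a := (c.1 r : ℕ))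
  have h2 := Finset.gcd_mul_left (s := Finset.univ) (f := fun s => (c.1 s : ℕ)) (a := (c'.1 r : ℕ))
  simp only [hcross r] at h1
  rw [h1, c.2, c'.2] at h2
  simpa using h2

/-- Termwise comparison with ζ(2) = π²/6. -/
lemma riemannZeta_re_le_two (hR : 2 ≤ R) : (riemannZeta (R : ℂ)).re ≤ 2 := by
  rw [zeta_nat_eq_tsum_of_gt_one (by omega)]
  have h1 : (∑' n : ℕ, 1 / (n : ℂ) ^ R) = ((∑' n : ℕ, 1 / (n : ℝ) ^ R : ℝ) : ℂ) := by
    push_cast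
    rfl
  rw [h1, Complex.ofReal_re]
  have h2 : (∑' n : ℕ, 1 / (n : ℝ) ^ R) ≤ ∑' n : ℕ, 1 / (n : ℝ) ^ 2 := by
    refine Summable.tsum_le_tsum (fun n => ?_) (Real.summable_one_div_nat_pow.2 (by omega))
      (Real.summable_one_div_nat_pow.2 (by omega))
    rcases Nat.eq_zero_or_pos n with rfl | hn
    · simp [show R ≠ 0 by omega]
    · have hn' : (1 : ℝ) ≤ n := by exact_mod_cast hn
      exact one_div_le_one_div_of_le (by positivity) (pow_le_pow_right₀ hn' hR)
  rw [hasSum_zeta_two.tsum_eq] at h2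
  have h3 : Real.pi ^ 2 ≤ 3.15 ^ 2 := pow_le_pow_left₀ Real.pi_pos.le Real.pi_lt_d2.le 2
  norm_num at h3
  linarith

end Primitive

/-! ## Coincidences among the measurements -/

section Coincidence

variable {E : Type*} {μ R M : ℕ}

/-- The measurements that the columns in `B` contribute to the group `i`. -/
noncomputable def resid (A : Design E μ R M) (d : E → ℝ) (B : Finset E) (i : Fin μ) (r : Fin R) :
    ℝ :=
  ∑ e ∈ B, ∑ p, if A.nbr e p = i then d e * A.weight e p r else 0

/-- The contribution of several columns to a group is never parallel to the weight vector
of another column. -/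
def Generic [DecidableEq E] (A : Design E μ R M) (d : E → ℝ) (S : Finset E) : Prop :=
  ∀ q : E × Fin 3, ∀ B ⊆ (incident A.1 S (A.nbr q.1 q.2)).erase q.1, ∀ c : ℝ, c ≠ 0 →
    ¬ ∀ r, resid A d B (A.nbr q.1 q.2) r = c * A.weight q.1 q.2 r

variable [Fintype E] [DecidableEq E]

/-- The residual of `B` does not involve the weight on the edge `q`, because the column of `q` is
not in `B`. With all other weights fixed, the weight on `q` must lie on a fixed line, which contains
at most one primitive vector. -/
lemma freq_parallel_le (g : E → (Fin 3 ↪ Fin μ)) (d : E → ℝ) (q : E × Fin 3) (B : Finset E)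
    (hq : q.1 ∉ B) (hcard : Fintype.card (E × Fin 3) ≤ Fintype.card (PrimVec M R)) :
    freq (fun w : (E × Fin 3) ↪ PrimVec M R => ∃ c : ℝ, c ≠ 0 ∧ ∀ r,
      resid (g, w) d B (g q.1 q.2) r = c * Design.weight (μ := μ) (g, w) q.1 q.2 r) ≤
      1 / ((Fintype.card (PrimVec M R) : ℝ) - Fintype.card (E × Fin 3) + 1) := by
  refine freq_embedding_determined_le q hcard _ ?_
  rintro w w' ⟨c, hc, h⟩ ⟨c', hc', h'⟩ hoff
  refine PrimVec.eq_of_smul_eq (t' := c') hc fun r => ?_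
  have h1 := h r
  have h2 := h' r
  have h3 : resid (g, w) d B (g q.1 q.2) r = resid (g, w') d B (g q.1 q.2) r := by
    refine Finset.sum_congr rfl fun e he => Finset.sum_congr rfl fun p _ => ?_
    have hne : (e, p) ≠ q := fun h => hq (h ▸ he)
    simp only [Design.weight, Design.nbr, hoff _ hne]
    rfl
  rw [h3, h2] at h1
  exact h1.symm

/-- Coincidences are unlikely when there are many primitive vectors. -/
lemma freq_not_generic_le (hμ : 4 ≤ μ) (d : E → ℝ) (S : Finset E) (hS : 6 * S.card ≤ μ)
    (hcard : Fintype.card (E × Fin 3) ≤ Fintype.card (PrimVec M R)) :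
    freq (fun A : Design E μ R M => ¬ Generic A d S) ≤
      9 * Fintype.card E * μ /
        ((Fintype.card (PrimVec M R) : ℝ) - Fintype.card (E × Fin 3) + 1) := by
  set N : ℝ := (Fintype.card (PrimVec M R) : ℝ) - Fintype.card (E × Fin 3) + 1 with hN
  have hN0 : 0 < N := by
    have : (Fintype.card (E × Fin 3) : ℝ) ≤ Fintype.card (PrimVec M R) := Nat.cast_le.2 hcard
    linarith
  have hμ0 : (0 : ℝ) < μ := Nat.cast_pos.2 (by omega)
  have hfix : ∀ g : E → (Fin 3 ↪ Fin μ),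
      freq (fun w : (E × Fin 3) ↪ PrimVec M R => ¬ Generic ((g, w) : Design E μ R M) d S) ≤
        ∑ _q : E × Fin 3, ∑ i : Fin μ, 1 / N * (2 : ℝ) ^ (incident g S i).card := by
    intro g
    calc _ ≤ freq (fun w : (E × Fin 3) ↪ PrimVec M R => ∃ q ∈ (Finset.univ : Finset (E × Fin 3)),
          ∃ B ∈ ((incident g S (g q.1 q.2)).erase q.1).powerset, ∃ c : ℝ, c ≠ 0 ∧ ∀ r,
          resid (g, w) d B (g q.1 q.2) r = c * Design.weight (μ := μ) (g, w) q.1 q.2 r) := by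
          refine freq_mono fun w hw => ?_
          simp only [Generic, not_forall] at hw
          obtain ⟨q, B, hB, c, hc, h⟩ := hw
          exact ⟨q, Finset.mem_univ _, B, Finset.mem_powerset.2 hB, c, hc, not_exists_not.1 h⟩
      _ ≤ _ := by
          refine (freq_exists_le _ _).trans (Finset.sum_le_sum fun q _ => ?_)
          refine (freq_exists_le _ _).trans ?_
          refine (Finset.sum_le_sum fun B hB => freq_parallel_le g d q B (fun h => ?_) hcard).trans ?_
          · exact Finset.notMem_erase _ _ (Finset.mem_powerset.1 hB h)
          rw [Finset.sum_const, Finset.card_powerset, nsmul_eq_mul, mul_comm]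
          -- The degree of the group of `q` is replaced by a sum over all groups. This costs a
          -- factor μ, but the average over the triples can then be taken for each fixed group
          -- separately.
          refine le_trans ?_ (Finset.single_le_sum
            (f := fun i => 1 / N * (2 : ℝ) ^ (incident g S i).card)
            (fun i _ => by positivity) (Finset.mem_univ (g q.1 q.2)))
          push_cast
          refine mul_le_mul_of_nonneg_left ?_ (by positivity)
          exact pow_le_pow_right₀ (by norm_num) (Finset.card_le_card (Finset.erase_subset _ _))
  have hmgf : ∀ i : Fin μ,
      mean (fun g : E → (Fin 3 ↪ Fin μ) => (2 : ℝ) ^ (incident g S i).card) ≤ 3 := by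
    intro i
    refine (mean_pow_card_incident_le hμ S i (by norm_num)).trans ?_
    have h1 : (2 - 1) * (6 / μ) * (S.card : ℝ) ≤ 1 := by
      have : (6 : ℝ) * S.card ≤ μ := by exact_mod_cast hS
      rw [show (2 - 1) * (6 / μ) * (S.card : ℝ) = 6 * S.card / μ by ring, div_le_one hμ0]
      exact this
    exact (Real.exp_le_exp.2 h1).trans (by linarith [Real.exp_one_lt_d9])
  rw [freq_prod]
  refine (mean_mono hfix).trans ?_
  rw [mean_sum]
  simp only [mean_sum, mean_const_mul]
  calc _ ≤ ∑ _q : E × Fin 3, ∑ _i : Fin μ, 1 / N * (3 : ℝ) :=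
        Finset.sum_le_sum fun q _ => Finset.sum_le_sum fun i _ =>
          mul_le_mul_of_nonneg_left (hmgf i) (by positivity)
    _ = _ := by
        simp only [Finset.sum_const, Finset.card_univ, Fintype.card_prod, Fintype.card_fin,
          nsmul_eq_mul]
        push_cast
        ring

end Coincidence

/-! ## The residuals of the decoder -/

section Residual

variable {E : Type*} {μ R M : ℕ} {A : Design E μ R M} {d : E → ℝ} {S : Finset E}

lemma sum_nbr_ite {e : E} {p : Fin 3} {i : Fin μ} (h : A.nbr e p = i) (r : Fin R) :
    (∑ p', if A.nbr e p' = i then d e * (A.weight e p' r : ℝ) else 0) =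
      d e * A.weight e p r := by
  rw [Finset.sum_eq_single p]
  · rw [if_pos h]
  · intro p' _ hp'
    rw [if_neg]
    intro h'
    exact hp' ((A.1 e).injective (h'.trans h.symm))
  · simp

lemma resid_incident (B : Finset E) (i : Fin μ) (r : Fin R) :
    resid A d (incident A.1 B i) i r = resid A d B i r := by
  refine Finset.sum_subset (Finset.filter_subset _ _) fun e he hne => ?_
  refine Finset.sum_eq_zero fun p _ => if_neg fun h => hne ?_
  exact Finset.mem_filter.2 ⟨he, p, h⟩

lemma incident_mono (g : E → (Fin 3 ↪ Fin μ)) {B S : Finset E} (h : B ⊆ S) (i : Fin μ) :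
    incident g B i ⊆ incident g S i :=
  Finset.filter_subset_filter _ h

lemma weight_pos (e : E) (p : Fin 3) (r : Fin R) : (0 : ℝ) < A.weight e p r :=
  Nat.cast_pos.2 (PrimVec.one_le _ r)

lemma exists_nbr_of_mem_incident {g : E → (Fin 3 ↪ Fin μ)} {B : Finset E} {i : Fin μ} {e : E}
    (h : e ∈ incident g B i) : ∃ p, g e p = i := (Finset.mem_filter.1 h).2

/-- In an expanding hypergraph, a third of the groups that are hit are hit just once. -/
lemma Expanding.card_nbrs_le {g : E → (Fin 3 ↪ Fin μ)} (hg : Expanding g S) {B : Finset E}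
    (hB : B ⊆ S) : (nbrs g B).card ≤
      3 * ((nbrs g B).filter fun i => (incident g B i).card = 1).card := by
  have hdouble : ∑ i ∈ nbrs g B, (incident g B i).card = 3 * B.card := by
    have h1 := Finset.sum_card_bipartiteAbove_eq_sum_card_bipartiteBelow
      (s := B) (t := nbrs g B) (fun e i => ∃ p, g e p = i)
    have h2 : ∀ e ∈ B, ((nbrs g B).bipartiteAbove (fun e i => ∃ p, g e p = i) e).card = 3 := by
      intro e he
      have : (nbrs g B).bipartiteAbove (fun e i => ∃ p, g e p = i) e =
          Finset.univ.map (g e) := by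
        ext i
        simp only [Finset.mem_bipartiteAbove, mem_nbrs, Finset.mem_map, Finset.mem_univ, true_and]
        exact ⟨fun h => h.2, fun h => ⟨⟨e, he, h⟩, h⟩⟩
      rw [this]
      simp
    rw [Finset.sum_congr rfl h2, Finset.sum_const, smul_eq_mul, mul_comm] at h1
    exact h1.symm
  have hpos : ∀ i ∈ nbrs g B, 1 ≤ (incident g B i).card := by
    intro i hi
    obtain ⟨e, he, h⟩ := mem_nbrs.1 hi
    exact Finset.card_pos.2 ⟨e, Finset.mem_filter.2 ⟨he, h⟩⟩
  -- A group hit at least twice contributes at least 2 to the sum of degrees; a leaf contributes 1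
  -- and is compensated by the last term.
  have hlow : 2 * (nbrs g B).card ≤ ∑ i ∈ nbrs g B, (incident g B i).card +
      ((nbrs g B).filter fun i => (incident g B i).card = 1).card := by
    rw [Finset.card_filter, ← Finset.sum_add_distrib, mul_comm, ← smul_eq_mul, ← Finset.sum_const]
    refine Finset.sum_le_sum fun i hi => ?_
    have := hpos i hi
    split_ifs <;> omega
  have hup : (nbrs g B).card ≤ ∑ i ∈ nbrs g B, (incident g B i).card := by
    rw [Finset.card_eq_sum_ones]
    exact Finset.sum_le_sum hpos
  -- With N neighbours and L leaves, 2N ≤ 3|B| + L and 2|B| ≤ N give N ≤ 2L, slightly more than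
  -- required.
  have := hg B hB
  omega

lemma resid_of_incident_eq_singleton {B : Finset E} {i : Fin μ} {e : E}
    (h : incident A.1 B i = {e}) {p : Fin 3} (hp : A.nbr e p = i) (r : Fin R) :
    resid A d B i r = d e * A.weight e p r := by
  rw [← resid_incident, h, resid, Finset.sum_singleton, sum_nbr_ite hp]

variable [DecidableEq E]

lemma resid_erase {B : Finset E} {e : E} (he : e ∈ B) (i : Fin μ) (r : Fin R) :
    resid A d (B.erase e) i r =
      resid A d B i r - ∑ p, if A.nbr e p = i then d e * A.weight e p r else 0 := by
  unfold resid
  rw [← Finset.add_sum_erase B _ he]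
  ring

/-- `Generic` only speaks of columns other than that of `q` and of factors c ≠ 0; the decoder needs
neither restriction. Removing the column of `q` from `B`, if present, only changes the factor, and
some column remains because |B| ≥ 2. If the new factor is 0, the remaining columns cancel, so all
but one of them, f, sum to −d_f times the weight of f, which `Generic` forbids as well. -/
lemma Generic.not_parallel (hA : Generic A d S) (hd : ∀ e ∈ S, d e ≠ 0) {i : Fin μ}
    {B : Finset E} (hB : B ⊆ incident A.1 S i) (h2 : 2 ≤ B.card) (q : E × Fin 3)
    (hq : A.nbr q.1 q.2 = i) (c : ℝ) : ¬ ∀ r, resid A d B i r = c * A.weight q.1 q.2 r := by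
  intro h
  subst hq
  obtain ⟨B', hB', hne, hqB', c', hc'⟩ : ∃ B' ⊆ B, B'.Nonempty ∧ q.1 ∉ B' ∧ ∃ c' : ℝ,
      ∀ r, resid A d B' (A.nbr q.1 q.2) r = c' * A.weight q.1 q.2 r := by
    by_cases hqB : q.1 ∈ B
    · refine ⟨B.erase q.1, Finset.erase_subset _ _, ?_, Finset.notMem_erase _ _, c - d q.1,
        fun r => ?_⟩
      · rw [← Finset.card_pos, Finset.card_erase_of_mem hqB]
        omega
      · rw [resid_erase hqB, sum_nbr_ite rfl, h r]
        ring
    · exact ⟨B, subset_rfl, Finset.card_pos.1 (by omega), hqB, c, h⟩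
  have hB'S := hB'.trans hB
  by_cases hc0 : c' = 0
  · obtain ⟨f, hf⟩ := hne
    obtain ⟨hfS, p, hp⟩ := Finset.mem_filter.1 (hB'S hf)
    have hp' : A.nbr f p = A.nbr q.1 q.2 := hp
    refine hA (f, p) (B'.erase f) ?_ (-d f) (neg_ne_zero.2 (hd f hfS)) fun r => ?_
    · rw [hp']
      exact Finset.erase_subset_erase _ hB'S
    · rw [hp', resid_erase hf, sum_nbr_ite hp', hc', hc0]
      ring
  · refine hA q B' (fun f hf => Finset.mem_erase.2 ⟨?_, hB'S hf⟩) c' hc0 hc'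
    rintro rfl
    exact hqB' hf

/-- Contributions never cancel: two or more columns cannot sum to zero by `Generic.not_parallel`
with c = 0, and a single one has d_e ≠ 0 and positive weights. Hence the active groups are the
neighbours of the unresolved columns. -/
lemma Generic.resid_ne_zero_iff (hA : Generic A d S) (hd : ∀ e ∈ S, d e ≠ 0) (hR : 0 < R)
    {B : Finset E} (hB : B ⊆ S) (i : Fin μ) : resid A d B i ≠ 0 ↔ i ∈ nbrs A.1 B := by
  constructor
  · intro h
    by_contra hi
    refine h (funext fun r => Finset.sum_eq_zero fun e he => Finset.sum_eq_zero fun p _ => ?_)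
    exact if_neg fun hp => hi (mem_nbrs.2 ⟨e, he, p, hp⟩)
  · intro h h0
    obtain ⟨e, he, p, hp⟩ := mem_nbrs.1 h
    have hmem : e ∈ incident A.1 B i := Finset.mem_filter.2 ⟨he, p, hp⟩
    by_cases h2 : 2 ≤ (incident A.1 B i).card
    · refine hA.not_parallel hd (incident_mono _ hB i) h2 (e, p) hp 0 fun r => ?_
      rw [resid_incident, h0]
      simp
    · have h1 : (incident A.1 B i).card = 1 := by
        have := Finset.card_pos.2 ⟨e, hmem⟩
        omega
      obtain ⟨f, hf⟩ := Finset.card_eq_one.1 h1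
      rw [hf, Finset.mem_singleton] at hmem
      subst hmem
      have h3 := resid_of_incident_eq_singleton (d := d) hf (p := p) hp ⟨0, hR⟩
      rw [h0] at h3
      exact mul_ne_zero (hd e (hB he)) (weight_pos e p _).ne' h3.symm

end Residual

/-! ## One iteration of the decoder -/

section Step

variable {E : Type*} {μ R M : ℕ} {A : Design E μ R M}

lemma identify_eq_none {i : Fin μ} {y : Fin R → ℝ}
    (h : ∀ q : E × Fin 3, A.nbr q.1 q.2 = i → ∀ c : ℝ, ¬ ∀ r, y r = c * A.weight q.1 q.2 r) :
    (identify A i y).val = none := by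
  by_cases hσ : ∑ r, y r = 0
  · simp [identify, Counted.bind, Counted.sum, Counted.isZero, Counted.pure, hσ]
  · have hl : (lookup A i fun r => y r / ∑ r, y r).val = none := by
      refine dif_neg ?_
      rintro ⟨q, hq, hk⟩
      refine h q hq ((∑ r, y r) / ∑ r, (A.weight q.1 q.2 r : ℝ)) fun r => ?_
      have := hk r
      rw [div_eq_iff hσ] at this
      rw [this]
      ring
    simp [identify, Counted.bind, Counted.sum, Counted.isZero, Counted.pure, hσ, Counted.all,
      Counted.div, hl]

lemma identify_eq_some (hR : 0 < R) {i : Fin μ} {y : Fin R → ℝ} {q : E × Fin 3}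
    (hq : A.nbr q.1 q.2 = i) {δ : ℝ} (hδ : δ ≠ 0) (h : ∀ r, y r = δ * A.weight q.1 q.2 r) :
    (identify A i y).val = some (q, δ) := by
  have hsum : ∀ q : E × Fin 3, (0 : ℝ) < ∑ r, (A.weight q.1 q.2 r : ℝ) := fun q =>
    Finset.sum_pos (fun r _ => weight_pos _ _ r) ⟨⟨0, hR⟩, Finset.mem_univ _⟩
  have hσ' : ∑ r, y r = δ * ∑ r, (A.weight q.1 q.2 r : ℝ) := by
    rw [Finset.mul_sum]
    exact Finset.sum_congr rfl fun r _ => h r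
  have hσ : ∑ r, y r ≠ 0 := by
    rw [hσ']
    exact mul_ne_zero hδ (hsum q).ne'
  have hl : (lookup A i fun r => y r / ∑ r, y r).val = some q := by
    have hex : ∃ q : E × Fin 3, A.nbr q.1 q.2 = i ∧ ∀ r, y r / ∑ r, y r =
        (A.weight q.1 q.2 r : ℝ) / ∑ r', (A.weight q.1 q.2 r' : ℝ) := by
      refine ⟨q, hq, fun r => ?_⟩
      rw [h r, hσ', mul_div_mul_left _ _ hδ]
    refine (dif_pos hex).trans (congrArg some ?_)
    -- The table could a priori return another edge with the same normalised vector. Its weight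
    -- would be parallel to that of `q`, hence equal to it, and different edges carry different
    -- vectors.
    have hs := hex.choose_spec.2
    refine A.2.injective ?_
    refine PrimVec.eq_of_smul_eq (t := (∑ r', (A.weight hex.choose.1 hex.choose.2 r' : ℝ))⁻¹)
      (t' := δ / ∑ r, y r) (inv_ne_zero (hsum _).ne') fun r => ?_
    have := hs r
    rw [h r] at this
    calc _ = (A.weight hex.choose.1 hex.choose.2 r : ℝ) /
          ∑ r', (A.weight hex.choose.1 hex.choose.2 r' : ℝ) := by
          rw [div_eq_inv_mul]; rfl
      _ = _ := by
          rw [← this, mul_div_right_comm]; rfl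
  have hδ' : (∑ r, y r) / ∑ r, (A.weight q.1 q.2 r : ℝ) = δ := by
    rw [hσ', mul_div_assoc, div_self (hsum q).ne', mul_one]
  simp [identify, Counted.bind, Counted.sum, Counted.isZero, Counted.pure, hσ, Counted.all,
    Counted.div, hl, hδ']

lemma cancel_dhat (e : E) (δ : ℝ) (p : Fin 3) (s : State E μ R) :
    (cancel A e δ p s).val.dhat = s.dhat := rfl

lemma cancel_res (e : E) (δ : ℝ) (p : Fin 3) (s : State E μ R) (i : Fin μ) (r : Fin R) :
    (cancel A e δ p s).val.res i r =
      s.res i r - if A.nbr e p = i then δ * A.weight e p r else 0 := by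
  by_cases h : A.nbr e p = i
  · subst h
    simp [cancel, Counted.bind, Counted.all, Counted.mul, Counted.sub, Counted.touch,
      Counted.isZeroVec]
  · simp [cancel, Counted.bind, Counted.touch, h, Function.update_of_ne (Ne.symm h)]

/-- The list of active groups is up to date. -/
def State.Consistent (s : State E μ R) : Prop := ∀ i, i ∈ s.active ↔ s.res i ≠ 0

lemma cancel_consistent (e : E) (δ : ℝ) (p : Fin 3) {s : State E μ R} (hs : s.Consistent) :
    (cancel A e δ p s).val.Consistent := by
  intro i
  set z : Fin R → ℝ := fun r => s.res (A.nbr e p) r - δ * A.weight e p r with hz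
  have hres : (cancel A e δ p s).val.res = Function.update s.res (A.nbr e p) z := rfl
  have hact : (cancel A e δ p s).val.active = if decide (z = 0) = true
      then s.active.erase (A.nbr e p) else insert (A.nbr e p) s.active := rfl
  rw [hres, hact]
  by_cases h : i = A.nbr e p
  · subst h
    rw [Function.update_self]
    by_cases h0 : z = 0 <;> simp [h0]
  · rw [Function.update_of_ne h]
    by_cases h0 : z = 0 <;> simp [h0, h, hs i]

variable [DecidableEq E]

/-- The columns in `B` remain to be found, and the others have been found. -/
structure Remaining (A : Design E μ R M) (d : E → ℝ) (B : Finset E) (s : State E μ R) : Prop where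
  dhat : ∀ e, s.dhat e = if e ∈ B then 0 else d e
  res : ∀ i r, s.res i r = resid A d B i r
  consistent : s.Consistent

variable {d : E → ℝ} {S : Finset E}

lemma Remaining.step_leaf {B : Finset E} {s : State E μ R} (hs : Remaining A d B s) (hR : 0 < R)
    (hd : ∀ e ∈ B, d e ≠ 0) {i : Fin μ} {e : E} (hi : incident A.1 B i = {e}) :
    Remaining A d (B.erase e) (step A i s).val := by
  have hmem : e ∈ incident A.1 B i := by rw [hi]; exact Finset.mem_singleton_self e
  have heB : e ∈ B := (Finset.mem_filter.1 hmem).1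
  obtain ⟨p, hp⟩ := exists_nbr_of_mem_incident hmem
  have hid : (identify A i (s.res i)).val = some ((e, p), d e) := by
    refine identify_eq_some hR (q := (e, p)) hp (hd e heB) fun r => ?_
    rw [hs.res]
    exact resid_of_incident_eq_singleton hi hp r
  set s₀ : State E μ R := { s with dhat := Function.update s.dhat e (s.dhat e + d e) } with hs₀
  have hstep : (step A i s).val = (cancel A e (d e) 2 (cancel A e (d e) 1
      (cancel A e (d e) 0 s₀).val).val).val := by
    simp only [step, Counted.bind, hid]
    rfl
  have hc₀ : s₀.Consistent := hs.consistent
  rw [hstep]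
  refine ⟨fun f => ?_, fun j r => ?_, cancel_consistent _ _ _ (cancel_consistent _ _ _
    (cancel_consistent _ _ _ hc₀))⟩
  · rw [cancel_dhat, cancel_dhat, cancel_dhat]
    by_cases h : f = e
    · subst h
      simp [hs₀, hs.dhat, heB]
    · simp [hs₀, hs.dhat, h]
  · rw [cancel_res, cancel_res, cancel_res, resid_erase heB, Fin.sum_univ_three]
    have : s₀.res j r = resid A d B j r := hs.res j r
    rw [this]
    ring

lemma Remaining.step_nonleaf {B : Finset E} {s : State E μ R} (hs : Remaining A d B s)
    (hA : Generic A d S) (hd : ∀ e ∈ S, d e ≠ 0) (hB : B ⊆ S) {i : Fin μ}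
    (hi : 2 ≤ (incident A.1 B i).card) : (step A i s).val = s := by
  have hid : (identify A i (s.res i)).val = none := by
    refine identify_eq_none fun q hq c h => ?_
    refine hA.not_parallel hd (incident_mono _ hB i) hi q hq c fun r => ?_
    rw [resid_incident, ← hs.res, h r]
  simp only [step, Counted.bind, hid]
  rfl

end Step

/-! ## The peeling process -/

section Peel

lemma ofReal_sum_le {ι : Type*} (s : Finset ι) (f : ι → ℝ) :
    ENNReal.ofReal (∑ i ∈ s, f i) ≤ ∑ i ∈ s, ENNReal.ofReal (f i) :=
  Finset.le_sum_of_subadditive ENNReal.ofReal ENNReal.ofReal_zero.le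
    (fun _ _ => ENNReal.ofReal_add_le) s f

/-- Law of total probability as a lower bound. The numbers `b a` may be negative, so a vacuous bound
on one branch does no harm to the average. -/
lemma ofReal_le_toOuterMeasure_bind {α β : Type*} [Fintype α] (p : PMF α) (f : α → PMF β)
    (s : Set β) (w b : α → ℝ) (hw : ∀ a, 0 ≤ w a) (hp : ∀ a, p a = ENNReal.ofReal (w a))
    (hb : ∀ a, w a ≠ 0 → ENNReal.ofReal (b a) ≤ (f a).toOuterMeasure s) :
    ENNReal.ofReal (∑ a, w a * b a) ≤ (p.bind f).toOuterMeasure s := by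
  rw [PMF.toOuterMeasure_bind_apply, tsum_fintype]
  refine (ofReal_sum_le _ _).trans (Finset.sum_le_sum fun a _ => ?_)
  by_cases h : w a = 0
  · simp [h]
  · rw [ENNReal.ofReal_mul (hw a), hp]
    exact mul_le_mul_right (hb a h) _

variable {E : Type*} [DecidableEq E] {μ R M : ℕ} {A : Design E μ R M} {d : E → ℝ} {S : Finset E}

/-- The peeling process succeeds unless it runs out of iterations. -/
lemma Remaining.peel_success (hA : Generic A d S) (hg : Expanding A.1 S) (hR : 0 < R)
    (hd : ∀ e ∈ S, d e ≠ 0) (T : ℕ) : ∀ (B : Finset E) (s : State E μ R), B ⊆ S →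
    Remaining A d B s → ENNReal.ofReal (1 - 2 ^ B.card * (5 / 6) ^ T) ≤
      (peel A T s).toOuterMeasure {x | x.val.dhat = d} := by
  have hempty : ∀ s : State E μ R, Remaining A d ∅ s → s.dhat = d := fun s hs =>
    funext fun e => by simp [hs.dhat]
  induction T with
  | zero =>
    intro B s _ hs
    rcases B.eq_empty_or_nonempty with rfl | _
    · have := hempty s hs
      simp [peel, Counted.pure, this]
    -- With unresolved columns and no iterations left, the claimed bound is at most 0.
    · have h1 : (1 : ℝ) ≤ 2 ^ B.card := one_le_pow₀ (by norm_num)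
      rw [pow_zero, mul_one, ENNReal.ofReal_of_nonpos (by linarith)]
      exact zero_le
  | succ T ih =>
    intro B s hB hs
    have hact : s.active = nbrs A.1 B := by
      ext i
      rw [hs.consistent, funext (hs.res i)]
      exact hA.resid_ne_zero_iff hd hR hB i
    by_cases hne : s.active.Nonempty
    · rw [peel, dif_pos hne]
      set L := s.active.filter fun i => (incident A.1 B i).card = 1 with hL
      have hLc : (s.active.card : ℝ) ≤ 3 * L.card := by
        have := hg.card_nbrs_le hB
        rw [← hact] at this
        exact_mod_cast this
      have hc : (0 : ℝ) < s.active.card := Nat.cast_pos.2 hne.card_pos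
      set X : ℝ := 2 ^ B.card * (5 / 6) ^ T with hX
      have hX0 : 0 ≤ X := by positivity
      -- A leaf removes one column and so halves the failure bound `X`; any other active group
      -- leaves the state unchanged. As at least a third of the active groups are leaves, the
      -- average factor is at most 1 − 1/3 · 1/2 = 5/6.
      have key := ofReal_le_toOuterMeasure_bind (PMF.uniformOfFinset s.active hne)
        (fun i => (peel A T (step A i s).val).map fun x =>
          (⟨x.val, 2 + (step A i s).ops + x.ops⟩ : Counted (State E μ R)))
        {x | x.val.dhat = d} (fun i => if i ∈ s.active then (s.active.card : ℝ)⁻¹ else 0)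
        (fun i => 1 - X * (1 - if (incident A.1 B i).card = 1 then 1 / 2 else 0))
        (fun i => by split_ifs <;> positivity) ?_ ?_
      · refine le_trans (ENNReal.ofReal_le_ofReal ?_) key
        simp only [ite_mul, zero_mul]
        rw [Finset.sum_ite_mem, Finset.univ_inter, ← Finset.mul_sum, Finset.sum_sub_distrib,
          ← Finset.mul_sum, Finset.sum_sub_distrib, ← Finset.sum_filter, ← hL]
        simp only [Finset.sum_const, nsmul_eq_mul, mul_one]
        rw [inv_mul_eq_div, le_div_iff₀ hc, pow_succ, ← mul_assoc, ← hX]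
        have := mul_le_mul_of_nonneg_left hLc hX0
        linarith
      · intro i
        rw [PMF.uniformOfFinset_apply]
        split_ifs
        · rw [ENNReal.ofReal_inv_of_pos hc, ENNReal.ofReal_natCast]
        · simp
      · intro i hi
        have hi' : i ∈ s.active := by
          by_contra h
          exact hi (if_neg h)
        rw [PMF.toOuterMeasure_map_apply]
        by_cases h1 : (incident A.1 B i).card = 1
        · obtain ⟨e, he⟩ := Finset.card_eq_one.1 h1
          have heB : e ∈ B := by
            have : e ∈ incident A.1 B i := by rw [he]; exact Finset.mem_singleton_self e
            exact (Finset.mem_filter.1 this).1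
          have := ih (B.erase e) _ ((Finset.erase_subset _ _).trans hB)
            (hs.step_leaf hR (fun f hf => hd f (hB hf)) he)
          rw [Finset.card_erase_of_mem heB] at this
          refine le_trans (ENNReal.ofReal_le_ofReal (le_of_eq ?_)) this
          obtain ⟨m, hm⟩ : ∃ m, B.card = m + 1 :=
            ⟨B.card - 1, by have := Finset.card_pos.2 ⟨e, heB⟩; omega⟩
          rw [if_pos h1, hX, hm, Nat.add_sub_cancel]
          ring
        · have h2 : 2 ≤ (incident A.1 B i).card := by
            rw [hact] at hi'
            obtain ⟨e, he, h⟩ := mem_nbrs.1 hi'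
            have : 0 < (incident A.1 B i).card :=
              Finset.card_pos.2 ⟨e, Finset.mem_filter.2 ⟨he, h⟩⟩
            omega
          rw [hs.step_nonleaf hA hd hB h2, if_neg h1, sub_zero, mul_one]
          exact ih B s hB hs
    · have hB0 : B = ∅ := by
        by_contra h
        obtain ⟨e, he⟩ := Finset.nonempty_iff_ne_empty.2 h
        refine hne ⟨A.1 e 0, ?_⟩
        rw [hact]
        exact mem_nbrs.2 ⟨e, he, 0, rfl⟩
      subst hB0
      have := hempty s hs
      rw [peel, dif_neg hne]
      simp only [PMF.toOuterMeasure_pure_apply, Set.mem_ofPred_eq, this, if_true]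
      have hX : (0 : ℝ) ≤ 2 ^ (∅ : Finset E).card * (5 / 6) ^ (T + 1) := by positivity
      exact ENNReal.ofReal_le_one.2 (by linarith)

lemma initState_remaining (y : Fin μ → Fin R → ℝ) (hd : ∀ e ∉ S, d e = 0)
    (hy : ∀ i r, y i r = resid A d S i r) : Remaining A d S (initState E y).val := by
  refine ⟨fun e => ?_, hy, fun i => ?_⟩
  · by_cases h : e ∈ S
    · simp [initState, Counted.bind, Counted.pure, h]
    · simp [initState, Counted.bind, Counted.pure, h, hd e h]
  · simp [initState, Counted.bind, Counted.pure, Counted.all, Counted.isZeroVec, Counted.touch]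

lemma decode_success (hA : Generic A d S) (hg : Expanding A.1 S) (hR : 0 < R)
    (hd : ∀ e, e ∈ S ↔ d e ≠ 0) (T : ℕ) (p q : Fin μ → Fin R → ℝ)
    (hpq : ∀ i r, (q i r - p i r) / 2 = resid A d S i r) :
    ENNReal.ofReal (1 - 2 ^ S.card * (5 / 6) ^ T) ≤
      (decode A T p q).toOuterMeasure {x | x.val = d} := by
  rw [decode, PMF.toOuterMeasure_map_apply]
  refine Remaining.peel_success hA hg hR (fun e he => (hd e).1 he) T S _ subset_rfl ?_
  refine initState_remaining _ (fun e he => ?_) hpq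
  by_contra h
  exact he ((hd e).2 h)

/-! ## The number of operations -/

omit [DecidableEq E] in
lemma identify_ops_le (i : Fin μ) (y : Fin R → ℝ) : (identify A i y).ops ≤ 4 * R + 2 := by
  simp only [identify, Counted.bind, Counted.sum, Counted.isZero, Counted.pure, Counted.all,
    Counted.div]
  split_ifs
  · simp
    omega
  · have hl : ∀ key : Fin R → ℝ, (lookup A i key).ops = R := fun _ => rfl
    simp only [hl]
    split <;> simp <;> omega

omit [DecidableEq E] in
lemma cancel_ops (e : E) (δ : ℝ) (p : Fin 3) (s : State E μ R) :
    (cancel A e δ p s).ops = 3 * R + 1 := by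
  simp [cancel, Counted.bind, Counted.all, Counted.mul, Counted.sub, Counted.touch,
    Counted.isZeroVec]
  ring

lemma step_ops_le (i : Fin μ) (s : State E μ R) : (step A i s).ops ≤ 13 * R + 6 := by
  have h := identify_ops_le (A := A) i (s.res i)
  simp only [step, Counted.bind]
  split
  · simp only [Counted.pure]
    omega
  · simp only [cancel_ops, Counted.add]
    omega

lemma peel_ops_le (T : ℕ) : ∀ (s : State E μ R), ∀ x ∈ (peel A T s).support,
    x.ops ≤ T * (13 * R + 8) + 1 := by
  induction T with
  | zero =>
    intro s x hx
    rw [peel, PMF.support_pure, Set.mem_singleton_iff] at hx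
    simp [hx, Counted.pure]
  | succ T ih =>
    intro s x hx
    rw [peel] at hx
    split_ifs at hx with h
    · rw [PMF.mem_support_bind_iff] at hx
      obtain ⟨i, _, hx⟩ := hx
      rw [PMF.mem_support_map_iff] at hx
      obtain ⟨x', hx', rfl⟩ := hx
      have h1 := ih _ x' hx'
      have h2 := step_ops_le (A := A) i s
      rw [Nat.succ_mul]
      dsimp only
      omega
    · rw [PMF.support_pure, Set.mem_singleton_iff] at hx
      simp [hx]

lemma decode_ops_le (T : ℕ) (p q : Fin μ → Fin R → ℝ) : ∀ x ∈ (decode A T p q).support,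
    x.ops ≤ μ * (3 * R + 1) + T * (13 * R + 8) + 1 := by
  intro x hx
  simp only [decode] at hx
  rw [PMF.mem_support_map_iff] at hx
  obtain ⟨x', hx', rfl⟩ := hx
  have h1 := peel_ops_le T _ x' hx'
  simp only [Counted.bind, initState, Counted.all, Counted.sub, Counted.div, Counted.isZeroVec,
    Counted.touch, Counted.pure, Finset.sum_const, Finset.card_univ, Fintype.card_fin,
    smul_eq_mul] at h1 ⊢
  have h2 : μ * (R * (1 + 1)) + (μ * (R + 1) + 0) = μ * (3 * R + 1) := by ring
  omega

end Peel

/-! ## Measurement paths -/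

section PathLemmas

variable {V : Type*} {G : SimpleGraph V}

lemma NetPath.hops_eq_delay (P : NetPath G) : (P.hops : ℝ) = P.delay fun _ => 1 := by
  simp [NetPath.hops, NetPath.delay]

lemma orient_edge (e : G.edgeSet) : (orient e).edge = e.1 := Quot.out_eq e.1

lemma mem_edges_tour (hG : G.Connected) (l : List G.Dart) (u : V) (a : G.Dart) (ha : a ∈ l) :
    a.edge ∈ (tour hG l u).2.edges := by
  induction l generalizing u with
  | nil => simp at ha
  | cons b l ih =>
    rw [tour, SimpleGraph.Walk.edges_append, SimpleGraph.Walk.edges_cons, List.mem_append,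
      List.mem_cons]
    rcases List.mem_cons.1 ha with rfl | h
    · exact Or.inr (Or.inl rfl)
    · exact Or.inr (Or.inr (ih _ h))

lemma length_tour_le (hG : G.Connected) {D : ℕ} (hD : ∀ u v, G.dist u v ≤ D) (l : List G.Dart)
    (u : V) : (tour hG l u).2.length ≤ l.length * (D + 1) := by
  induction l generalizing u with
  | nil => simp [tour]
  | cons b l ih =>
    have h1 : (geodesic hG u b.fst).length = G.dist u b.fst :=
      (hG.exists_walk_length_eq_dist u b.fst).choose_spec
    have h2 := hD u b.fst
    have h3 := ih b.snd
    rw [tour, SimpleGraph.Walk.length_append, SimpleGraph.Walk.length_cons, List.length_cons, h1,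
      Nat.succ_mul]
    omega

lemma hops_spanningPath_le [Fintype G.edgeSet] (hG : G.Connected) {D : ℕ}
    (hD : ∀ u v, G.dist u v ≤ D) (w : G.edgeSet → ℕ) :
    (spanningPath hG w).hops ≤ (Finset.univ.filter fun e => w e ≠ 0).card * (D + 1) := by
  have hlen : ((Finset.univ.filter fun e => w e ≠ 0).toList.map orient : List G.Dart).length =
      (Finset.univ.filter fun e => w e ≠ 0).card := by simp
  rw [← hlen]
  unfold spanningPath
  split
  · simp [NetPath.hops]
  · rename_i a l h
    rw [h]
    exact length_tour_le hG hD _ _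

variable [DecidableEq V]

lemma NetPath.delay_eq_sum [Fintype G.edgeSet] (P : NetPath G) (d : G.edgeSet → ℝ) :
    P.delay d = ∑ e, (P.mult e : ℝ) * d e := by
  have key : ∀ l : List G.Dart, (l.map fun a => d ⟨a.edge, a.edge_mem⟩).sum =
      ∑ e : G.edgeSet, (((l.map SimpleGraph.Dart.edge).count e.1 : ℕ) : ℝ) * d e := by
    intro l
    induction l with
    | nil => simp
    | cons a l ih =>
      rw [List.map_cons, List.sum_cons, ih]
      simp only [List.map_cons, List.count_cons, Nat.cast_add, add_mul, Finset.sum_add_distrib]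
      rw [add_comm]
      congr 1
      rw [Finset.sum_eq_single (⟨a.edge, a.edge_mem⟩ : G.edgeSet)]
      · simp
      · intro e _ he
        have : a.edge ≠ e.1 := fun h => he (Subtype.ext h.symm)
        simp [this]
      · simp
  exact key _

lemma NetPath.links_le_hops (P : NetPath G) : P.links ≤ P.hops := by
  refine (List.toFinset_card_le _).trans ?_
  rw [SimpleGraph.Walk.length_edges]
  rfl

lemma NetPath.mem_edges_iff (P : NetPath G) (e : G.edgeSet) :
    e.1 ∈ P.walk.edges ↔ 1 ≤ P.mult e :=
  List.one_le_count_iff.symm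

/-- Extra crossings occur only on links with non-zero weight, and `P` already traverses those. -/
lemma NetPath.links_weighted_le {P Q : NetPath G} {w : G.edgeSet → ℕ} (hP : P.IsSpanning w)
    (hQ : Q.IsWeighted P w) : Q.links ≤ P.links := by
  refine Finset.card_le_card fun e he => ?_
  rw [List.mem_toFinset] at he ⊢
  have heG := SimpleGraph.Walk.edges_subset_edgeSet _ he
  have h1 := (Q.mem_edges_iff ⟨e, heG⟩).1 he
  refine (P.mem_edges_iff ⟨e, heG⟩).2 ?_
  rw [hQ] at h1
  by_cases hw : w ⟨e, heG⟩ = 0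
  · omega
  · exact hP _ hw

lemma NetPath.delay_sub_div_two [Fintype G.edgeSet] {P Q : NetPath G} {w : G.edgeSet → ℕ}
    (hQ : Q.IsWeighted P w) (d : G.edgeSet → ℝ) :
    (Q.delay d - P.delay d) / 2 = ∑ e, (w e : ℝ) * d e := by
  rw [Q.delay_eq_sum, P.delay_eq_sum, ← Finset.sum_sub_distrib, Finset.sum_div]
  refine Finset.sum_congr rfl fun e _ => ?_
  rw [hQ]
  push_cast
  ring

/-- The number of hops is the delay when every link has delay 1, so the delay identity applies. -/
lemma NetPath.hops_weighted_eq [Fintype G.edgeSet] {P Q : NetPath G} {w : G.edgeSet → ℕ}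
    (hQ : Q.IsWeighted P w) : Q.hops = P.hops + 2 * ∑ e, w e := by
  have h := NetPath.delay_sub_div_two hQ fun _ => 1
  rw [← Q.hops_eq_delay, ← P.hops_eq_delay] at h
  have : (Q.hops : ℝ) = ((P.hops + 2 * ∑ e, w e : ℕ) : ℝ) := by
    push_cast
    simp only [mul_one] at h
    linarith
  exact_mod_cast this

lemma spanningPath_isSpanning [Fintype G.edgeSet] (hG : G.Connected) (w : G.edgeSet → ℕ) :
    (spanningPath hG w).IsSpanning w := by
  intro e he
  rw [← NetPath.mem_edges_iff, ← orient_edge]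
  have hmem : orient e ∈ ((Finset.univ.filter fun e => w e ≠ 0).toList.map orient : List G.Dart) :=
    List.mem_map_of_mem (by simpa using he)
  unfold spanningPath
  split
  · rename_i h
    rw [h] at hmem
    simp at hmem
  · rename_i a l h
    rw [h] at hmem
    exact mem_edges_tour hG _ _ _ hmem

lemma count_edges_bounce {u v x : V} (h : G.Adj u v) (m : ℕ) (p : G.Walk v x) (e : Sym2 V) :
    (bounce h m p).edges.count e = p.edges.count e + if s(u, v) = e then 2 * m else 0 := by
  induction m with
  | zero => simp [bounce]
  | succ m ih =>
    rw [bounce, SimpleGraph.Walk.edges_cons, SimpleGraph.Walk.edges_cons, List.count_cons,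
      List.count_cons, ih, Sym2.eq_swap (a := v)]
    by_cases hs : s(u, v) = e
    · simp [hs]; ring
    · simp [hs]

/-- The list `seen` is kept general for the induction: loops at `e` are added once, at its first
visit, and never if `e` was seen before. -/
lemma count_edges_addLoops (w : G.edgeSet → ℕ) (seen : List (Sym2 V)) {u v : V} (p : G.Walk u v)
    (e : G.edgeSet) : (addLoops w seen p).edges.count e.1 =
      p.edges.count e.1 + if e.1 ∈ p.edges ∧ e.1 ∉ seen then 2 * w e else 0 := by
  induction p generalizing seen with
  | nil => simp [addLoops]
  | @cons u v x h p ih =>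
    rw [addLoops, SimpleGraph.Walk.edges_cons, List.count_cons, count_edges_bounce, ih,
      SimpleGraph.Walk.edges_cons, List.count_cons]
    by_cases hs : s(u, v) = e.1
    · have he : (⟨s(u, v), h⟩ : G.edgeSet) = e := Subtype.ext hs
      rw [he]
      by_cases hm : e.1 ∈ seen <;> simp [hs, hm]; ring
    · have hs' : ¬ e.1 = s(u, v) := fun h => hs h.symm
      simp [hs, hs', List.mem_cons]

lemma weightedPath_isWeighted {P : NetPath G} {w : G.edgeSet → ℕ} (hP : P.IsSpanning w) :
    (weightedPath w P).IsWeighted P w := by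
  intro e
  have h := count_edges_addLoops w [] P.walk e
  rw [NetPath.mult, weightedPath, h]
  by_cases hw : w e = 0
  · simp [hw, NetPath.mult]
  · have := (P.mem_edges_iff e).2 (hP e hw)
    simp [this, NetPath.mult]

end PathLemmas

/-! ## Test packets of the random design -/

section Packets

variable {V : Type*} [Fintype V] [DecidableEq V] {G : SimpleGraph V} [DecidableRel G.Adj]
  {μ R M : ℕ}

lemma matrix_eq_zero {E : Type*} [Fintype E] {A : Design E μ R M} {i : Fin μ} {e : E}
    (h : e ∉ incident A.1 Finset.univ i) (r : Fin R) : A.matrix (i, r) e = 0 := by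
  refine Finset.sum_eq_zero fun p _ => if_neg fun hp => h ?_
  exact Finset.mem_filter.2 ⟨Finset.mem_univ _, p, hp⟩

lemma matrix_le {E : Type*} (A : Design E μ R M) (i : Fin μ) (r : Fin R) (e : E) :
    A.matrix (i, r) e ≤ M := by
  by_cases h : ∃ p, A.nbr e p = i
  · obtain ⟨p, hp⟩ := h
    have : A.matrix (i, r) e = A.weight e p r := by
      unfold Design.matrix
      rw [Finset.sum_eq_single p]
      · rw [if_pos hp]
      · intro p' _ hp'
        rw [if_neg]
        intro h'
        exact hp' ((A.1 e).injective (h'.trans hp.symm))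
      · simp
    rw [this]
    exact PrimVec.le _ r
  · push Not at h
    have : A.matrix (i, r) e = 0 := Finset.sum_eq_zero fun p _ => if_neg (h p)
    omega

lemma sum_matrix_mul {E : Type*} [Fintype E] (A : Design E μ R M) (d : E → ℝ) {S : Finset E}
    (hd : ∀ e ∉ S, d e = 0) (i : Fin μ) (r : Fin R) :
    ∑ e, (A.matrix (i, r) e : ℝ) * d e = resid A d S i r := by
  rw [resid, ← Finset.sum_subset (Finset.subset_univ S)
    (fun e _ he => by rw [hd e he, mul_zero])]
  refine Finset.sum_congr rfl fun e _ => ?_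
  simp only [Design.matrix, Nat.cast_sum, Finset.sum_mul]
  refine Finset.sum_congr rfl fun p _ => ?_
  split_ifs
  · ring
  · simp

lemma pathP_isSpanning (hG : G.Connected) (A : Design G.edgeSet μ R M) (i : Fin μ) (r : Fin R) :
    (pathP hG A i r).IsSpanning (A.matrix (i, r)) :=
  spanningPath_isSpanning hG _

lemma pathQ_isWeighted (hG : G.Connected) (A : Design G.edgeSet μ R M) (i : Fin μ) (r : Fin R) :
    (pathQ hG A i r).IsWeighted (pathP hG A i r) (A.matrix (i, r)) :=
  weightedPath_isWeighted (pathP_isSpanning hG A i r)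

lemma pathP_hops_le (hG : G.Connected) {D : ℕ} (hD : ∀ u v, G.dist u v ≤ D) (hD1 : 1 ≤ D)
    (A : Design G.edgeSet μ R M) (i : Fin μ) (r : Fin R) :
    (pathP hG A i r).hops ≤ 2 * D * (incident A.1 Finset.univ i).card := by
  refine (hops_spanningPath_le hG hD _).trans ?_
  rw [mul_comm]
  refine Nat.mul_le_mul (by omega) (Finset.card_le_card fun e he => ?_)
  by_contra h
  exact (Finset.mem_filter.1 he).2 (matrix_eq_zero h r)

lemma packet_links_le (hG : G.Connected) {D : ℕ} (hD : ∀ u v, G.dist u v ≤ D) (hD1 : 1 ≤ D)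
    (A : Design G.edgeSet μ R M) (x : Fin μ × Fin R × Bool) :
    (packet hG A x).links ≤ 2 * D * (incident A.1 Finset.univ x.1).card := by
  have h := (NetPath.links_le_hops _).trans (pathP_hops_le hG hD hD1 A x.1 x.2.1)
  unfold packet
  split_ifs
  · exact (NetPath.links_weighted_le (pathP_isSpanning hG A x.1 x.2.1)
      (pathQ_isWeighted hG A x.1 x.2.1)).trans h
  · exact h

lemma packet_hops_le (hG : G.Connected) {D : ℕ} (hD : ∀ u v, G.dist u v ≤ D) (hD1 : 1 ≤ D)
    (hM : 1 ≤ M) (A : Design G.edgeSet μ R M) (x : Fin μ × Fin R × Bool) :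
    (packet hG A x).hops ≤ 4 * (D * M) * (incident A.1 Finset.univ x.1).card := by
  have h := pathP_hops_le hG hD hD1 A x.1 x.2.1
  have hsum : ∑ e, A.matrix (x.1, x.2.1) e ≤ (incident A.1 Finset.univ x.1).card * M := by
    rw [← Finset.sum_subset (Finset.subset_univ (incident A.1 Finset.univ x.1))
      (fun e _ he => matrix_eq_zero he x.2.1), ← smul_eq_mul, ← Finset.sum_const]
    exact Finset.sum_le_sum fun e _ => matrix_le A _ _ e
  set X := (incident A.1 Finset.univ x.1).card
  have h1 : D * X ≤ D * M * X := Nat.mul_le_mul_right _ (Nat.le_mul_of_pos_right _ hM)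
  have h2 : X * M ≤ D * M * X := by
    rw [mul_comm X]
    exact Nat.mul_le_mul_right _ (Nat.le_mul_of_pos_left _ hD1)
  have h3 : 2 * D * X = 2 * (D * X) := by ring
  have h4 : 4 * (D * M) * X = 4 * (D * M * X) := by ring
  unfold packet
  split_ifs
  · rw [NetPath.hops_weighted_eq (pathQ_isWeighted hG A x.1 x.2.1)]
    omega
  · omega

end Packets

/-! ## Success of the scheme -/

section Success

lemma sum_uniform_mul {Ω : Type*} [Fintype Ω] [Nonempty Ω] (f : Ω → ℝ) :
    ∑ x, (PMF.uniformOfFintype Ω x).toReal * f x = mean f := by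
  simp only [PMF.uniformOfFintype_apply, ENNReal.toReal_inv, ENNReal.toReal_natCast,
    ← Finset.mul_sum]
  rw [mean, div_eq_inv_mul]

lemma sum_ensemble_mul {E : Type*} [Fintype E] [DecidableEq E] {μ R M : ℕ}
    [Nonempty (Design E μ R M)] (f : Design E μ R M → ℝ) :
    ∑ A, (ensemble E μ R M A).toReal * f A = mean f :=
  sum_uniform_mul f

lemma freq_le_one {Ω : Type*} [Fintype Ω] [Nonempty Ω] (p : Ω → Prop) : freq p ≤ 1 := by
  have h1 := freq_not p
  have h2 := freq_nonneg fun x => ¬ p x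
  linarith

variable {V : Type*} [Fintype V] [DecidableEq V] {G : SimpleGraph V} [DecidableRel G.Adj]
  {μ R M : ℕ}

lemma frantic_success (hG : G.Connected) (T : ℕ) [Nonempty (Design G.edgeSet μ R M)]
    (hR : 0 < R) (d : G.edgeSet → ℝ) (S : Finset G.edgeSet) (hd : ∀ e, e ∈ S ↔ d e ≠ 0) {β : ℝ}
    (hβ : freq (fun A : Design G.edgeSet μ R M => ¬ (Generic A d S ∧ Expanding A.1 S)) ≤ β) :
    ENNReal.ofReal (1 - (β + 2 ^ S.card * (5 / 6) ^ T)) ≤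
      (frantic hG μ R M T d).toOuterMeasure {x | x.val = d} := by
  classical
  set ε : ℝ := 2 ^ S.card * (5 / 6) ^ T with hε
  have hε0 : 0 ≤ ε := by positivity
  have hd0 : ∀ e ∉ S, d e = 0 := fun e he => by
    by_contra h
    exact he ((hd e).2 h)
  have key := ofReal_le_toOuterMeasure_bind (ensemble G.edgeSet μ R M)
    (fun A => decode A T (fun i r => (pathP hG A i r).delay d)
      (fun i r => (pathQ hG A i r).delay d)) {x | x.val = d}
    (fun _ => (Fintype.card (Design G.edgeSet μ R M) : ℝ)⁻¹)
    (fun A => (1 - ε) * if Generic A d S ∧ Expanding A.1 S then 1 else 0)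
    (fun A => by positivity) ?_ ?_
  · refine le_trans (ENNReal.ofReal_le_ofReal ?_) key
    rw [← Finset.mul_sum, ← div_eq_inv_mul]
    have h1 : (∑ A : Design G.edgeSet μ R M,
        (1 - ε) * if Generic A d S ∧ Expanding A.1 S then (1 : ℝ) else 0) /
          (Fintype.card (Design G.edgeSet μ R M) : ℝ) = (1 - ε) *
        freq fun A : Design G.edgeSet μ R M => Generic A d S ∧ Expanding A.1 S := by
      unfold freq
      rw [← mean_const_mul, mean]
      congr!
    rw [h1]
    rw [freq_not] at hβ
    -- Since the proportion F of good designs is at most 1, (1 − ε)F ≥ F − ε, which remains valid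
    -- when ε > 1.
    have h2 := freq_le_one fun A : Design G.edgeSet μ R M => Generic A d S ∧ Expanding A.1 S
    nlinarith
  · intro A
    rw [ensemble, PMF.uniformOfFintype_apply, ENNReal.ofReal_inv_of_pos
      (Nat.cast_pos.2 Fintype.card_pos), ENNReal.ofReal_natCast]
  · intro A _
    by_cases h : Generic A d S ∧ Expanding A.1 S
    · rw [if_pos h, mul_one]
      refine decode_success h.1 h.2 hR hd T _ _ fun i r => ?_
      rw [NetPath.delay_sub_div_two (pathQ_isWeighted hG A i r)]
      exact sum_matrix_mul A d hd0 i r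
    · rw [if_neg h, mul_zero, ENNReal.ofReal_zero]
      exact zero_le

/-- Here 2^s ≤ e^k and (5/6)^T ≤ e^(−T/6) ≤ e^(−a−k), so the product is at most e^(−a) ≤ 1/a. -/
lemma two_pow_mul_pow_le {a : ℝ} (ha : 0 < a) {k s T : ℕ} (hs : s ≤ k)
    (hT : 6 * a + 6 * k ≤ T) : (2 : ℝ) ^ s * (5 / 6) ^ T ≤ 1 / a := by
  have h1 : (2 : ℝ) ^ s ≤ Real.exp k := by
    calc (2 : ℝ) ^ s ≤ 2 ^ k := pow_le_pow_right₀ (by norm_num) hs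
      _ ≤ Real.exp 1 ^ k := pow_le_pow_left₀ (by norm_num)
          (by linarith [Real.add_one_le_exp (1 : ℝ)]) _
      _ = Real.exp k := Real.exp_one_pow k
  have h2 : (5 / 6 : ℝ) ^ T ≤ Real.exp (-(a + k)) := by
    calc (5 / 6 : ℝ) ^ T ≤ Real.exp (-(1 / 6)) ^ T := pow_le_pow_left₀ (by norm_num)
          (by linarith [Real.add_one_le_exp (-(1 / 6) : ℝ)]) _
      _ = Real.exp (T * -(1 / 6)) := (Real.exp_nat_mul _ _).symm
      _ ≤ _ := Real.exp_le_exp.2 (by linarith)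
  calc (2 : ℝ) ^ s * (5 / 6) ^ T ≤ Real.exp k * Real.exp (-(a + k)) := by gcongr
    _ = Real.exp (-a) := by rw [← Real.exp_add]; congr 1; ring
    _ ≤ 1 / a := by
        rw [Real.exp_neg, inv_eq_one_div]
        exact one_div_le_one_div_of_le ha (by linarith [Real.add_one_le_exp a])

/-- With more than n³ available primitive vectors, coincidences have probability at most 9nμ/n³ ≤
9κa/n², and a ≤ n turns this into 9κ/a. Failure of expansion contributes 4/μ ≤ 4/(ca). -/
lemma freq_bad_le {E : Type*} [Fintype E] [DecidableEq E] (hμ : 4 ≤ μ) (d : E → ℝ)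
    (S : Finset E) (hS : 250 * S.card ≤ μ) {n : ℕ} (hn : n = Fintype.card E) (hn2 : 2 ≤ n)
    (hcard : 3 * (n : ℝ) + (n : ℝ) ^ 3 ≤ Fintype.card (PrimVec M R)) {a κ c : ℝ} (ha : 0 < a)
    (han : a ≤ n) (hc : 0 < c) (hκ : μ ≤ κ * a) (hca : c * a ≤ μ) :
    freq (fun A : Design E μ R M => ¬ (Generic A d S ∧ Expanding A.1 S)) ≤
      (9 * κ + 4 / c) / a := by
  have hn0 : (0 : ℝ) < n := Nat.cast_pos.2 (by omega)
  have hμ0 : (0 : ℝ) < μ := Nat.cast_pos.2 (by omega)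
  have hE3 : (Fintype.card (E × Fin 3) : ℝ) = 3 * n := by
    rw [Fintype.card_prod, Fintype.card_fin, ← hn]; push_cast; ring
  have hle : Fintype.card (E × Fin 3) ≤ Fintype.card (PrimVec M R) := by
    have : (Fintype.card (E × Fin 3) : ℝ) ≤ Fintype.card (PrimVec M R) := by
      rw [hE3]
      have : (0 : ℝ) < (n : ℝ) ^ 3 := by positivity
      linarith
    exact_mod_cast this
  have : Nonempty ((E × Fin 3) ↪ PrimVec M R) := Function.Embedding.nonempty_of_card_le hle
  have h1 := freq_not_generic_le hμ d S (by omega) hle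
  have h2 : freq (fun A : Design E μ R M => ¬ Expanding A.1 S) ≤ 4 / μ := by
    rw [freq_fst fun g : E → (Fin 3 ↪ Fin μ) => ¬ Expanding g S]
    exact freq_not_expanding_le (by omega) S hS
  have h3 : 9 * (Fintype.card E : ℝ) * μ /
      ((Fintype.card (PrimVec M R) : ℝ) - Fintype.card (E × Fin 3) + 1) ≤ 9 * κ / a := by
    rw [hE3, ← hn]
    calc 9 * (n : ℝ) * μ / ((Fintype.card (PrimVec M R) : ℝ) - 3 * n + 1)
        ≤ 9 * (n : ℝ) * μ / (n : ℝ) ^ 3 := by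
          refine div_le_div_of_nonneg_left (by positivity) (by positivity) (by linarith)
      _ ≤ 9 * (n : ℝ) * (κ * a) / (n : ℝ) ^ 3 := by gcongr
      _ = 9 * κ * a / (n : ℝ) ^ 2 := by field_simp
      _ ≤ 9 * κ * a / a ^ 2 := by
          have hκ0 : 0 < κ * a := hμ0.trans_le hκ
          refine div_le_div_of_nonneg_left (by nlinarith) (by positivity) ?_
          exact pow_le_pow_left₀ ha.le han 2
      _ = 9 * κ / a := by field_simp
  have h4 : (4 : ℝ) / μ ≤ 4 / c / a := by
    rw [div_div]
    exact div_le_div_of_nonneg_left (by norm_num) (by positivity) hca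
  calc _ ≤ freq (fun A : Design E μ R M => ¬ Generic A d S ∨ ¬ Expanding A.1 S) :=
        freq_mono fun A h => not_and_or.1 h
    _ ≤ _ := freq_or_le _ _
    _ ≤ 9 * κ / a + 4 / c / a := add_le_add (h1.trans h3) (h2.trans h4)
    _ = _ := by ring

/-- Because M^ℓ ≥ n, taking R = 6ℓ gives M^R ≥ n⁶ ≥ 2(3n + n³), and at least half of the M^R vectors
are primitive. -/
lemma three_mul_add_pow_le {n ℓ : ℕ} (hn : 2 ≤ n) (hM : 2 ≤ M)
    (hℓ : ℓ = ⌈Real.log n / Real.log M⌉₊) :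
    (n : ℝ) ^ 6 ≤ (M : ℝ) ^ (6 * ℓ) ∧ 6 * (n : ℝ) + 2 * (n : ℝ) ^ 3 ≤ (n : ℝ) ^ 6 := by
  have hn' : (2 : ℝ) ≤ n := by exact_mod_cast hn
  have hM' : (2 : ℝ) ≤ M := by exact_mod_cast hM
  constructor
  · rw [mul_comm, pow_mul]
    refine pow_le_pow_left₀ (by positivity) ?_ 6
    have h1 : Real.log n / Real.log M ≤ ℓ := by rw [hℓ]; exact Nat.le_ceil _
    rw [div_le_iff₀ (Real.log_pos (by linarith)), ← Real.log_pow] at h1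
    exact (Real.log_le_log_iff (by linarith) (by positivity)).1 h1
  · have h2 : (4 : ℝ) ≤ (n : ℝ) ^ 2 := by nlinarith
    have h3 : (8 : ℝ) ≤ (n : ℝ) ^ 3 := by nlinarith
    nlinarith

end Success

/-! ## The scheme with all parameters -/

section Parameters

variable {V : Type*} [Fintype V] [DecidableEq V] {G : SimpleGraph V} [DecidableRel G.Adj]
  {μ R M n D : ℕ}

/-- The number of columns incident to a group is at most a multiple of the average one,
except with exponentially small probability. -/
lemma freq_lt_card_incident_design_le {E : Type*} [Fintype E] [DecidableEq E]
    [Nonempty ((E × Fin 3) ↪ PrimVec M R)] (hn : n = Fintype.card E)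
    (hμ : 4 ≤ μ) (i : Fin μ) {a c : ℝ} (ha : 0 < a) (hc : 0 < c) (hca : c * a ≤ μ) :
    freq (fun A : Design E μ R M =>
      (12 / c + 1) * (n / a) < (incident A.1 Finset.univ i).card) ≤ Real.exp (-(n / a)) := by
  rw [freq_fst fun g : E → (Fin 3 ↪ Fin μ) =>
      (12 / c + 1) * (n / a) < (incident g Finset.univ i).card]
  refine freq_lt_card_incident_le hμ _ i ?_
  rw [Finset.card_univ, ← hn]
  have : (12 : ℝ) / μ ≤ 12 / (c * a) :=
    div_le_div_of_nonneg_left (by norm_num) (by positivity) hca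
  have h2 := mul_le_mul_of_nonneg_right this (Nat.cast_nonneg n : (0 : ℝ) ≤ n)
  have h3 : (12 / c + 1) * (n / a) = 12 / (c * a) * n + n / a := by field_simp
  linarith

/-- The bounds on the length of a packet. -/
def Short (hG : G.Connected) (C a : ℝ) (n D : ℕ) (A : Design G.edgeSet μ R M)
    (x : Fin μ × Fin R × Bool) : Prop :=
  ((packet hG A x).links : ℝ) ≤ C * (D * n / a) ∧
    ((packet hG A x).hops : ℝ) ≤ C * (D * M * n / a)

lemma short_of_card_le (hG : G.Connected) (hD : ∀ u v, G.dist u v ≤ D) (hD1 : 1 ≤ D)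
    (hM : 1 ≤ M) {C c' a : ℝ} (hC : 4 * c' ≤ C) (ha : 0 < a) (hc' : 0 ≤ c')
    {A : Design G.edgeSet μ R M} {x : Fin μ × Fin R × Bool}
    (h : ((incident A.1 Finset.univ x.1).card : ℝ) ≤ c' * (n / a)) : Short hG C a n D A x := by
  have h1 : ((packet hG A x).links : ℝ) ≤ 2 * D * (incident A.1 Finset.univ x.1).card := by
    exact_mod_cast packet_links_le hG hD hD1 A x
  have h2 : ((packet hG A x).hops : ℝ) ≤ 4 * (D * M) * (incident A.1 Finset.univ x.1).card := by
    exact_mod_cast packet_hops_le hG hD hD1 hM A x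
  constructor
  · calc _ ≤ 2 * (D : ℝ) * (c' * (n / a)) := h1.trans (by gcongr)
      _ = (2 * c') * (D * n / a) := by ring
      _ ≤ _ := by gcongr; linarith
  · calc _ ≤ 4 * ((D : ℝ) * M) * (c' * (n / a)) := h2.trans (by gcongr)
      _ = (4 * c') * (D * M * n / a) := by ring
      _ ≤ _ := by gcongr

lemma mean_packet_le (hG : G.Connected) (hD : ∀ u v, G.dist u v ≤ D) (hD1 : 1 ≤ D)
    (hM : 1 ≤ M) [Nonempty ((G.edgeSet × Fin 3) ↪ PrimVec M R)]
    (hn : n = Fintype.card G.edgeSet) (hμ : 4 ≤ μ) {C a c : ℝ} (ha : 0 < a) (hc : 0 < c)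
    (hca : c * a ≤ μ) (hC : 24 / c ≤ C) (x : Fin μ × Fin R × Bool) :
    mean (fun A : Design G.edgeSet μ R M => ((packet hG A x).links : ℝ)) ≤ C * (D * n / a) ∧
    mean (fun A : Design G.edgeSet μ R M => ((packet hG A x).hops : ℝ)) ≤
      C * (D * M * n / a) := by
  have h0 : mean (fun A : Design G.edgeSet μ R M =>
      ((incident A.1 Finset.univ x.1).card : ℝ)) ≤ 6 / c * (n / a) := by
    rw [mean_fst fun g : G.edgeSet → (Fin 3 ↪ Fin μ) => ((incident g Finset.univ x.1).card : ℝ)]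
    refine (mean_card_incident_le hμ _ x.1).trans ?_
    rw [Finset.card_univ, ← hn]
    calc (6 : ℝ) / μ * n ≤ 6 / (c * a) * n := by gcongr
      _ = _ := by field_simp
  constructor
  · calc _ ≤ mean (fun A : Design G.edgeSet μ R M =>
          2 * (D : ℝ) * ((incident A.1 Finset.univ x.1).card : ℝ)) :=
          mean_mono fun A => by exact_mod_cast packet_links_le hG hD hD1 A x
      _ ≤ 2 * (D : ℝ) * (6 / c * (n / a)) := by rw [mean_const_mul]; gcongr
      _ = (24 / c / 2) * (D * n / a) := by ring
      _ ≤ _ := by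
          gcongr
          have : 0 < 24 / c := by positivity
          linarith
  · calc _ ≤ mean (fun A : Design G.edgeSet μ R M =>
          4 * ((D : ℝ) * M) * ((incident A.1 Finset.univ x.1).card : ℝ)) :=
          mean_mono fun A => by exact_mod_cast packet_hops_le hG hD hD1 hM A x
      _ ≤ 4 * ((D : ℝ) * M) * (6 / c * (n / a)) := by rw [mean_const_mul]; gcongr
      _ = (24 / c) * (D * M * n / a) := by ring
      _ ≤ _ := by gcongr

end Parameters

end Frantic

/-! ### The main theorem: choice of the constants and assembly. -/

theorem mainTheorem2 (ρ₀ : ℝ) (hρ₀ : 0 < ρ₀) :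
    ∃ (c₁ c₃ C : ℝ) (c₂ : ℕ), 0 < c₁ ∧ 0 < c₃ ∧ 0 < C ∧ 0 < c₂ ∧
    ∀ (V : Type*) [Fintype V] [DecidableEq V] (G : SimpleGraph V) [DecidableRel G.Adj]
      (hG : G.Connected) (M k n D : ℕ) (ρ : ℝ) (ℓ μ R T : ℕ),
      n = Fintype.card G.edgeSet → D = G.diam →
      2 ≤ n → 2 ≤ M → 1 ≤ k → ρ₀ ≤ ρ → ρ * k ≤ n →
      ℓ = ⌈Real.log n / Real.log M⌉₊ →
      μ = ⌈c₁ * (ρ * k)⌉₊ → R = c₂ * ℓ → T = ⌈c₃ * (ρ * k)⌉₊ →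
      -- the design exists
      2 ≤ R ∧ 3 * (n : ℝ) * (riemannZeta (R : ℂ)).re ≤ (M : ℝ) ^ R ∧
      ∃ _ : Nonempty (Frantic.Design G.edgeSet μ R M),
        -- the measurements are pairs of a spanning and a weighted path that realise the matrix
        (∀ (A : Frantic.Design G.edgeSet μ R M) (i : Fin μ) (r : Fin R),
          (Frantic.pathP hG A i r).IsSpanning (A.matrix (i, r)) ∧
          (Frantic.pathQ hG A i r).IsWeighted (Frantic.pathP hG A i r) (A.matrix (i, r)) ∧
          ∀ d : G.edgeSet → ℝ,
            ((Frantic.pathQ hG A i r).delay d - (Frantic.pathP hG A i r).delay d) / 2 =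
              ∑ e, (A.matrix (i, r) e : ℝ) * d e) ∧
        -- number of pairs of path measurements
        ((μ * R : ℕ) : ℝ) ≤ C * (ρ * k * ℓ) ∧
        -- exact recovery and number of operations
        (∀ d : G.edgeSet → ℝ, (Function.support d).ncard ≤ k →
          ENNReal.ofReal (1 - C / (ρ * k)) ≤
            (Frantic.frantic hG μ R M T d).toOuterMeasure {x | x.val = d} ∧
          ∀ x ∈ (Frantic.frantic hG μ R M T d).support, (x.ops : ℝ) ≤ C * (ρ * k * ℓ)) ∧
        -- path lengths: in expectation, for each packet with high probability, for all packets
        (∀ x : Fin μ × Fin R × Bool,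
          ∑ A, (Frantic.ensemble G.edgeSet μ R M A).toReal * (Frantic.packet hG A x).links ≤
            C * (D * n / (ρ * k)) ∧
          ∑ A, (Frantic.ensemble G.edgeSet μ R M A).toReal * (Frantic.packet hG A x).hops ≤
            C * (D * M * n / (ρ * k)) ∧
          ENNReal.ofReal (1 - Real.exp (-(n / (ρ * k)))) ≤
            (Frantic.ensemble G.edgeSet μ R M).toOuterMeasure
              {A | ((Frantic.packet hG A x).links : ℝ) ≤ C * (D * n / (ρ * k)) ∧
                ((Frantic.packet hG A x).hops : ℝ) ≤ C * (D * M * n / (ρ * k))}) ∧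
        ENNReal.ofReal (1 - C * (ρ * k) * Real.exp (-(n / (ρ * k)))) ≤
          (Frantic.ensemble G.edgeSet μ R M).toOuterMeasure
            {A | ∀ x : Fin μ × Fin R × Bool,
              ((Frantic.packet hG A x).links : ℝ) ≤ C * (D * n / (ρ * k)) ∧
              ((Frantic.packet hG A x).hops : ℝ) ≤ C * (D * M * n / (ρ * k))} := by

  -- From ρ ≥ ρ₀ one gets 1 ≤ k ≤ ua. Hence c₁ yields μ ≥ 250k and c₃ yields T ≥ 6a + 6k, while the
  -- extra u in κ and τ absorbs the rounding up.
  set u : ℝ := 1 / ρ₀ with hu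
  have hu0 : 0 < u := by positivity
  set c₁ : ℝ := 250 * u with hc₁
  set c₃ : ℝ := 6 + 6 * u with hc₃
  set κ : ℝ := c₁ + u with hκ
  set τ : ℝ := c₃ + u with hτ
  set v : ℝ := 1 / c₁ with hv
  have hc₁0 : 0 < c₁ := by positivity
  have hc₃0 : 0 < c₃ := by positivity
  have hκ0 : 0 < κ := by positivity
  have hτ0 : 0 < τ := by positivity
  have hv0 : 0 < v := by positivity
  -- Large enough for every use: 6κ (measurements), 9κ + 4v + 1 (recovery), 19κ + 86τ + u
  -- (operations), 24v (mean lengths), 48v + 4 (tails of lengths) and κ (all packets at once).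
  set C : ℝ := 100 * κ + 100 * τ + u + 60 * v + 5 with hC
  have hC0 : 0 < C := by positivity
  refine ⟨c₁, c₃, C, 6, hc₁0, hc₃0, hC0, by norm_num, ?_⟩
  intro V _ _ G _ hG M k n D ρ ℓ μ R T hn hD hn2 hM hk hρ hρk hℓ hμ hR hT
  set a : ℝ := ρ * k with ha
  have hk' : (1 : ℝ) ≤ k := by exact_mod_cast hk
  have hρ0 : 0 < ρ := hρ₀.trans_le hρ
  have ha0 : 0 < a := by positivity
  have hua : (k : ℝ) ≤ u * a := by
    rw [hu, one_div, inv_mul_eq_div, le_div_iff₀ hρ₀, ha, mul_comm]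
    gcongr
  have hμlow : c₁ * a ≤ μ := by rw [hμ]; exact Nat.le_ceil _
  have hμup : (μ : ℝ) ≤ κ * a := by
    have := (Nat.ceil_lt_add_one (show 0 ≤ c₁ * a by positivity)).le
    rw [← hμ] at this
    linarith [add_mul c₁ u a]
  have hTlow : c₃ * a ≤ T := by rw [hT]; exact Nat.le_ceil _
  have hTup : (T : ℝ) ≤ τ * a := by
    have := (Nat.ceil_lt_add_one (show 0 ≤ c₃ * a by positivity)).le
    rw [← hT] at this
    linarith [add_mul c₃ u a]
  have hμk : 250 * k ≤ μ := by
    have : (250 : ℝ) * k ≤ μ := by linarith [mul_assoc 250 u a]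
    exact_mod_cast this
  have hμ4 : 4 ≤ μ := by omega
  have hℓ1 : 1 ≤ ℓ := by
    rw [hℓ]
    refine Nat.ceil_pos.2 (div_pos (Real.log_pos ?_) (Real.log_pos ?_))
    · exact_mod_cast hn2
    · exact_mod_cast hM
  have hℓ1' : (1 : ℝ) ≤ ℓ := by exact_mod_cast hℓ1
  have hpow := Frantic.three_mul_add_pow_le hn2 hM hℓ
  rw [← hR] at hpow
  have hcard : 3 * (n : ℝ) + (n : ℝ) ^ 3 ≤ Fintype.card (Frantic.PrimVec M R) := by
    have := Frantic.pow_le_two_mul_card_primVec (M := M) (R := R) (by omega)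
    linarith
  have hn0 : (0 : ℝ) < n := Nat.cast_pos.2 (by omega)
  have hn3 : (0 : ℝ) < (n : ℝ) ^ 3 := by positivity
  have hemb : Nonempty ((G.edgeSet × Fin 3) ↪ Frantic.PrimVec M R) := by
    refine Function.Embedding.nonempty_of_card_le ?_
    rw [Fintype.card_prod, Fintype.card_fin, ← hn]
    have : ((n * 3 : ℕ) : ℝ) ≤ Fintype.card (Frantic.PrimVec M R) := by push_cast; linarith
    exact_mod_cast this
  have htri : Nonempty (Fin 3 ↪ Fin μ) := Frantic.nonempty_triple (by omega)
  have hne : Nonempty (Frantic.Design G.edgeSet μ R M) := inferInstance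
  have hdist : ∀ x y, G.dist x y ≤ D := by
    intro x y
    have := hG.nonempty
    rw [hD]
    -- `diam` would be 0 if the extended diameter were infinite; finiteness and connectedness
    -- exclude this.
    exact SimpleGraph.dist_le_diam (SimpleGraph.connected_iff_ediam_ne_top.1 hG)
  have hD1 : 1 ≤ D := by
    obtain ⟨⟨e, he⟩⟩ : Nonempty G.edgeSet := Fintype.card_pos_iff.1 (by omega)
    induction e with
    | _ x y =>
      have h1 : G.dist x y = 1 := SimpleGraph.dist_eq_one_iff_adj.2 he
      have h2 := hdist x y
      omega
  have hva : ∀ t : ℝ, t / c₁ = t * v := fun t => by rw [hv]; ring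
  have hCt : 4 * (12 / c₁ + 1) ≤ C := by rw [hva]; linarith
  have htail : ∀ i : Fin μ, Frantic.freq (fun A : Frantic.Design G.edgeSet μ R M =>
      (12 / c₁ + 1) * (n / a) < (Frantic.incident A.1 Finset.univ i).card) ≤
        Real.exp (-(n / a)) := fun i =>
    Frantic.freq_lt_card_incident_design_le hn hμ4 i ha0 hc₁0 hμlow
  have hshort : ∀ (A : Frantic.Design G.edgeSet μ R M) (x : Fin μ × Fin R × Bool),
      ¬ (12 / c₁ + 1) * (n / a) < (Frantic.incident A.1 Finset.univ x.1).card →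
        Frantic.Short hG C a n D A x := fun A x h =>
    Frantic.short_of_card_le hG hdist hD1 (by omega) hCt ha0 (by positivity) (not_lt.1 h)
  refine ⟨by omega, ?_, hne, ?_, ?_, ?_, ?_, ?_⟩
  · have h1 := Frantic.riemannZeta_re_le_two (R := R) (by omega)
    have h2 : 3 * (n : ℝ) * (riemannZeta (R : ℂ)).re ≤ 3 * n * 2 := by gcongr
    linarith
  · exact fun A i r => ⟨Frantic.pathP_isSpanning hG A i r, Frantic.pathQ_isWeighted hG A i r,
      Frantic.NetPath.delay_sub_div_two (Frantic.pathQ_isWeighted hG A i r)⟩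
  · rw [hR]
    push_cast
    calc (μ : ℝ) * (6 * ℓ) ≤ κ * a * (6 * ℓ) := by gcongr
      _ = (6 * κ) * (a * ℓ) := by ring
      _ ≤ C * (a * ℓ) := by gcongr; linarith
  · intro d hd
    constructor
    · classical
      set S : Finset G.edgeSet := Finset.univ.filter fun e => d e ≠ 0 with hS
      have hSd : ∀ e, e ∈ S ↔ d e ≠ 0 := fun e => by simp [hS]
      have hSk : S.card ≤ k := by
        rw [← Set.ncard_coe_finset]
        convert hd using 2
        ext e
        simp [hS]
      have h1 := Frantic.frantic_success hG T (by omega) d S hSd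
        (Frantic.freq_bad_le hμ4 d S (by omega) hn hn2 hcard ha0 hρk hc₁0 hμup hμlow)
      refine le_trans (ENNReal.ofReal_le_ofReal ?_) h1
      have h2 : (2 : ℝ) ^ S.card * (5 / 6) ^ T ≤ 1 / a :=
        Frantic.two_pow_mul_pow_le ha0 hSk (by linarith [add_mul 6 (6 * u) a, mul_assoc 6 u a])
      have h3 : (9 * κ + 4 / c₁) / a + 1 / a ≤ C / a := by
        rw [← add_div, hva]
        gcongr
        linarith
      linarith
    · intro x hx
      rw [Frantic.frantic, PMF.mem_support_bind_iff] at hx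
      obtain ⟨A, _, hx⟩ := hx
      have h1 := Frantic.decode_ops_le T _ _ x hx
      have h2 : (x.ops : ℝ) ≤ μ * (3 * R + 1) + T * (13 * R + 8) + 1 := by exact_mod_cast h1
      have hR' : (R : ℝ) = 6 * ℓ := by rw [hR]; push_cast; ring
      have h4 : (1 : ℝ) ≤ u * a * ℓ := by nlinarith
      calc (x.ops : ℝ) ≤ μ * (3 * R + 1) + T * (13 * R + 8) + 1 := h2
        -- As R = 6ℓ and ℓ ≥ 1, 3R + 1 ≤ 19ℓ and 13R + 8 ≤ 86ℓ; the final 1 is at most uaℓ.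
        _ ≤ κ * a * (19 * ℓ) + τ * a * (86 * ℓ) + u * a * ℓ := by
            rw [hR']
            gcongr <;> linarith
        _ = (19 * κ + 86 * τ + u) * (a * ℓ) := by ring
        _ ≤ C * (a * ℓ) := by gcongr; linarith
  · intro x
    have h1 := Frantic.mean_packet_le (M := M) (R := R) (n := n) (D := D) (C := C) hG hdist hD1 (by omega) hn hμ4
      ha0 hc₁0 hμlow (by rw [hva]; linarith) x
    refine ⟨?_, ?_, ?_⟩
    · exact (Frantic.sum_ensemble_mul _).trans_le h1.1
    · exact (Frantic.sum_ensemble_mul _).trans_le h1.2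
    · rw [Frantic.ensemble, Frantic.uniform_toOuterMeasure]
      refine ENNReal.ofReal_le_ofReal ?_
      calc 1 - Real.exp (-(n / a)) ≤ _ := sub_le_sub_left (htail x.1) 1
        _ = _ := (Frantic.freq_not _).symm
        _ ≤ _ := Frantic.freq_mono fun A h => hshort A x h
  · rw [Frantic.ensemble, Frantic.uniform_toOuterMeasure]
    refine ENNReal.ofReal_le_ofReal ?_
    -- All 2R packets of a group are controlled by its degree, so the union runs over the μ groups
    -- only and no factor ℓ appears.
    have h1 := Frantic.freq_exists_le (Finset.univ : Finset (Fin μ))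
      fun i (A : Frantic.Design G.edgeSet μ R M) =>
        (12 / c₁ + 1) * (n / a) < (Frantic.incident A.1 Finset.univ i).card
    have h2 := h1.trans (Finset.sum_le_sum fun i _ => htail i)
    rw [Finset.sum_const, Finset.card_univ, Fintype.card_fin, nsmul_eq_mul] at h2
    have h3 : (μ : ℝ) * Real.exp (-(n / a)) ≤ C * a * Real.exp (-(n / a)) := by
      gcongr
      refine hμup.trans ?_
      gcongr
      linarith
    calc 1 - C * a * Real.exp (-(n / a)) ≤ _ := sub_le_sub_left (h2.trans h3) 1
      _ = _ := (Frantic.freq_not _).symm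
      _ ≤ _ := Frantic.freq_mono fun A h x => hshort A x fun hx =>
          h ⟨x.1, Finset.mem_univ _, hx⟩
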